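/- Let $\mathcal I$ be a building, that is, a simplicial complex together with a family of subcomplexes, called apartments, such that: each apartment is a Coxeter complex (of finite rank); any two simplices lie in a common apartment; and whenever two simplices $s,t$ lie in two apartments $A$ and $B$, there is an isomorphism of simplicial complexes $A\to B$ fixing $s$ and $t$ pointwise (here the empty simplex is allowed). For adjacent chambers $c,d$ of an apartment $A$, the half-apartment $\mathcal D(c,d)$ is the union of the closed chambers of $A$ that are strictly closer to $c$ than to $d$ for the gallery distance; a set of simplices of $A$ is called closed in $A$ if it is an intersection of half-apartments of $A$ (the empty intersection being $A$). Let $A$ and $B$ be two apartments of $\mathcal I$. Then: 1. $A\cap B$ is closed in $A$ and closed in $B$. 2. There is a type-preserving isomorphism $\varphi : A\to B$ which fixes $A\cap B$ pointwise. (Type-preserving: every labelling of the vertices of $\mathcal I$ that is bijective from the vertex set of each chamber to the set of labels is preserved by $\varphi$.) 3. If $\psi : A\to B$ is any isomorphism of simplicial complexes which fixes pointwise a simplex of maximal dimension of $A\cap B$, then $\psi$ fixes $A\cap B$ pointwise. -/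

import Mathlib

/-! ### Simplicial complexes: vertices, isomorphisms, chambers -/

namespace PreAbstractSimplicialComplex

variable {V V' : Type*}

/-- The vertices of a simplicial complex. -/
def vertices (K : PreAbstractSimplicialComplex V) : Set V := {v | {v} ∈ K}

/-- `s` is a simplex of `K`, the empty simplex being allowed (it is not among `K.faces`). -/
def IsSimplex (K : PreAbstractSimplicialComplex V) (s : Finset V) : Prop := s = ∅ ∨ s ∈ K

/-- An isomorphism of simplicial complexes: a bijection between the vertices which, together with
its inverse, sends simplices to simplices. -/
structure Iso (K : PreAbstractSimplicialComplex V) (L : PreAbstractSimplicialComplex V') where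
  /-- the bijection on vertices -/
  toEquiv : K.vertices ≃ L.vertices
  map_mem_iff : ∀ s : Finset K.vertices,
    (s.map toEquiv.toEmbedding).map (Function.Embedding.subtype _) ∈ L ↔
      s.map (Function.Embedding.subtype _) ∈ K

/-- The isomorphism `φ : K → L` between two complexes with vertices in `V` fixes (pointwise) the
simplex `s`: it fixes every vertex of `s`. -/
def Iso.Fixes {K L : PreAbstractSimplicialComplex V} (φ : Iso K L) (s : Finset V) : Prop :=
  ∀ v : K.vertices, (v : V) ∈ s → (φ.toEquiv v : V) = v

/-- A chamber is a maximal simplex. -/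
def IsChamber (K : PreAbstractSimplicialComplex V) (c : Finset V) : Prop :=
  Maximal (· ∈ K) c

/-- The graph of chambers of `K`: two distinct chambers are adjacent if they have a common face of
codimension one in both (this face is the empty simplex when chambers are single vertices). Walks
in this graph are the galleries of `K`. -/
def chamberGraph (K : PreAbstractSimplicialComplex V) :
    SimpleGraph {c : Finset V // K.IsChamber c} where
  Adj c d := c ≠ d ∧ ∃ p : Finset V, p ⊆ c.1 ∧ p ⊆ d.1 ∧
    p.card + 1 = c.1.card ∧ p.card + 1 = d.1.card
  symm := ⟨fun _ _ ⟨h, p, hc, hd, h1, h2⟩ => ⟨h.symm, p, hd, hc, h2, h1⟩⟩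
  loopless := ⟨fun _ h => h.1 rfl⟩

/-- The union of the closed chambers of `K` which are strictly closer (for the gallery distance)
to `c` than to `d`, as a set of simplices. -/
def closerTo (K : PreAbstractSimplicialComplex V) (c d : {c : Finset V // K.IsChamber c}) :
    Set (Finset V) :=
  {s | s ∈ K ∧ ∃ e : {c : Finset V // K.IsChamber c},
    K.chamberGraph.dist e c < K.chamberGraph.dist e d ∧ s ⊆ e.1}

/-- The (closed) half-apartments of a Coxeter complex: the sets of simplices `D(c, d)`, for
adjacent chambers `c` and `d`. -/
def IsHalfApartment (K : PreAbstractSimplicialComplex V) (H : Set (Finset V)) : Prop :=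
  ∃ c d, K.chamberGraph.Adj c d ∧ H = K.closerTo c d

/-- A set of simplices of a Coxeter complex `K` is closed if it is an intersection of
half-apartments of `K` (`K` itself being the intersection of the empty family). -/
def IsClosedIn (K : PreAbstractSimplicialComplex V) (Z : Set (Finset V)) : Prop :=
  ∃ 𝓗 : Set (Set (Finset V)), (∀ H ∈ 𝓗, K.IsHalfApartment H) ∧ Z = K.faces ∩ ⋂₀ 𝓗

end PreAbstractSimplicialComplex

/-! ### Coxeter complexes -/

namespace CoxeterMatrix

variable {S : Type*} (M : CoxeterMatrix S)

/-- The maximal standard parabolic subgroup, generated by the simple reflections other than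
`i`. -/
def maximalParabolic (i : S) : Subgroup M.Group :=
  Subgroup.closure (M.simple '' {j | j ≠ i})

/-- The Coxeter complex of the Coxeter system with matrix `M`: its vertices are the left cosets of
the maximal standard parabolic subgroups, and vertices span a simplex if they are cosets of one
and the same element `w` of the group, that is, if they are vertices of the chamber `w`. -/
def coxeterComplex : PreAbstractSimplicialComplex (Σ i : S, M.Group ⧸ M.maximalParabolic i) where
  faces := {s | s.Nonempty ∧ ∃ w : M.Group, ∀ v ∈ s, v.2 = (w : M.Group ⧸ M.maximalParabolic v.1)}
  isRelLowerSet_faces := by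
    rintro s ⟨hs, w, hw⟩
    exact ⟨hs, fun t hts ht => ⟨ht, w, fun v hv => hw v (hts hv)⟩⟩

end CoxeterMatrix

/-- A simplicial complex is a Coxeter complex if it is isomorphic to the Coxeter complex of some
Coxeter system of finite rank. -/
def PreAbstractSimplicialComplex.IsCoxeterComplex {V : Type*}
    (K : PreAbstractSimplicialComplex V) : Prop :=
  ∃ (n : ℕ) (M : CoxeterMatrix (Fin n)),
    Nonempty (PreAbstractSimplicialComplex.Iso M.coxeterComplex K)

/-! ### Buildings -/

/-- A building: a simplicial complex with a system of subcomplexes, the apartments, which are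
Coxeter complexes, such that any two simplices lie in a common apartment, and such that for any two
simplices in two apartments `A`, `B` there is an isomorphism `A → B` fixing both of them. The empty
simplex counts among the simplices here. Neither thickness nor completeness of the system of
apartments is required. -/
structure Building (V : Type*) extends AbstractSimplicialComplex V where
  /-- the system of apartments -/
  apartments : Set (PreAbstractSimplicialComplex V)
  apartment_le : ∀ A ∈ apartments, A ≤ toPreAbstractSimplicialComplex
  isCoxeterComplex : ∀ A ∈ apartments, A.IsCoxeterComplex
  exists_apartment : ∀ s t : Finset V, toPreAbstractSimplicialComplex.IsSimplex s →
    toPreAbstractSimplicialComplex.IsSimplex t →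
    ∃ A ∈ apartments, A.IsSimplex s ∧ A.IsSimplex t
  exists_iso : ∀ A ∈ apartments, ∀ B ∈ apartments, ∀ s t : Finset V,
    A.IsSimplex s → A.IsSimplex t → B.IsSimplex s → B.IsSimplex t →
    ∃ φ : PreAbstractSimplicialComplex.Iso A B, φ.Fixes s ∧ φ.Fixes t

namespace Building

variable {V : Type*}

/-- A type function (labelling) on the vertices of a building: it restricts to a bijection from
the vertices of each chamber onto the set of labels. Every building has one, and it is unique up to
a permutation of the labels. -/
def IsTypeFunction (Δ : Building V) {n : ℕ} (τ : V → Fin n) : Prop :=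
  ∀ c, Δ.toPreAbstractSimplicialComplex.IsChamber c → Set.BijOn τ c Set.univ

/-- An isomorphism between two subcomplexes of a building preserves types. -/
def TypePreserving (Δ : Building V) {A B : PreAbstractSimplicialComplex V}
    (φ : PreAbstractSimplicialComplex.Iso A B) : Prop :=
  ∀ (n : ℕ) (τ : V → Fin n), Δ.IsTypeFunction τ → ∀ v : A.vertices, τ (φ.toEquiv v) = τ v

end Building

/-!
Everything is done in charts, that is, in parametrizations of the apartments by one Coxeter group
`W`: chambers are elements of `W`, a simplex is a coset `x W_I` of a standard parabolic subgroup,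
and the walls containing it are those of the reflections in `x W_I x⁻¹`. The group theory rests on
the exchange condition, which follows from the action of `W` on signed reflections
(`CoxeterSystem.length_mul_simple_lt_iff`).

**Projections.** For a simplex `f` and a chamber `x` of an apartment, the chamber containing `f`
which is closest to `x` does not depend on the apartment: a retraction does not lengthen galleries,
see `Building.vertex_eq_of_isLeftReduced`. Hence the intersection `Z` of two apartments is stable
under projections of simplices to simplices (`Building.face_isSimplex_of_isLeftReduced`). If `d` is
a simplex of maximal dimension in `Z`, the projection of another simplex of `Z` to `d` must be `d`;
so all of `Z` lies on each wall that contains `d` (`Building.conj_mem_of_card_le`). Let `L` be the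
intersection of these walls.

**Thinness of `L`.** The simplices of maximal dimension in `L` are connected by galleries in `L`
(`CoxeterSystem.IsTransporter.exists_eq_mul`), and a simplex of codimension one in `L` lies in at
most two of them (`CoxeterSystem.IsTransporter.eq_of_mem_parabolic`). The latter is the crucial
point; it is proved in the Coxeter monoid. Consequently an automorphism of an apartment which fixes
`d` fixes `L` (`CoxeterSystem.IsTransporter.apply_eq`,
`PreAbstractSimplicialComplex.Chart.vertex_eq_of_conj_mem`), and this shows that an isomorphism
between the two apartments which fixes `d` fixes `Z`. A type-preserving one is the composition of
two isomorphisms through an apartment that contains a chamber of each.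

**Closedness.** A simplex `e` of the first apartment outside `Z` has to be separated from `Z` by a
half-apartment. If `e` is not in `L`, a wall containing `d` does it. If `e` is in `L`, take `d` and a
chamber containing `e` as close to each other as possible, and a wall which contains a facet of `d`
and separates `d` from `e`. A simplex of `Z` beyond this wall would have a projection to the facet
which, by thinness, is the next simplex on a gallery in `L` from `d` to `e`, and closer to `e` than
`d` is; see `Building.exists_separating`.
-/

/-! ### Simple reflections are distinct -/

namespace CoxeterMatrix

open Polynomial.Chebyshev

variable {B : Type*} (M : CoxeterMatrix B)

/-- Twice the inner product of the `i`-th and `j`-th simple roots in the standard geometric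
representation. Since `π / 0 = 0`, the entry `0` (that is, infinite order) gives `-2`. -/
noncomputable def rootPairing (i j : B) : ℝ := -2 * Real.cos (Real.pi / M i j)

/-- The coroot of the `i`-th simple root. -/
noncomputable def simpleCoroot (i : B) : Module.Dual ℝ (B →₀ ℝ) :=
  Finsupp.linearCombination ℝ (M.rootPairing i)

theorem simpleCoroot_single (i j : B) :
    M.simpleCoroot i (Finsupp.single j 1) = M.rootPairing i j := by
  simp [simpleCoroot]

theorem simpleCoroot_self (i : B) : M.simpleCoroot i (Finsupp.single i 1) = 2 := by
  simp [simpleCoroot_single, rootPairing]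

/-- The action of the `i`-th simple reflection in the standard geometric representation. -/
noncomputable def geometricReflection (i : B) : (B →₀ ℝ) ≃ₗ[ℝ] (B →₀ ℝ) :=
  Module.reflection (M.simpleCoroot_self i)

theorem sin_add_sin_eq_zero {θ : ℝ} {p : ℤ} (h : Real.sin ((2 * p + 1) * (θ / 2)) = 0) :
    Real.sin ((p + 1) * θ) + Real.sin (p * θ) = 0 := by
  have h1 : ((p : ℝ) + 1) * θ = (2 * p + 1) * (θ / 2) + θ / 2 := by ring
  have h2 : (p : ℝ) * θ = (2 * p + 1) * (θ / 2) - θ / 2 := by ring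
  rw [h1, h2, Real.sin_add, Real.sin_sub, h]
  ring

theorem geometricReflection_pow (i j : B) :
    (M.geometricReflection i * M.geometricReflection j) ^ M i j = 1 := by
  by_cases hij : i = j
  · subst hij
    rw [M.diagonal, pow_one]
    ext1 x
    exact Module.involutive_reflection (M.simpleCoroot_self i) x
  have hm1 := M.off_diagonal i j hij
  have hsymm := M.symmetric i j
  apply LinearEquiv.toLinearMap_injective
  rcases Nat.lt_or_ge (M i j) 3 with h3 | h3
  · have h02 : M i j = 0 ∨ M i j = 2 := by omega
    rcases h02 with h0 | h2
    · rw [h0]; simp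
    · have hp : M.rootPairing i j = 0 := by simp [rootPairing, h2]
      have hp' : M.rootPairing j i = 0 := by simp [rootPairing, ← hsymm, h2]
      rw [h2, geometricReflection, geometricReflection,
        Module.reflection_mul_reflection_pow (M.simpleCoroot_self i) (M.simpleCoroot_self j) 2]
      simp only [simpleCoroot_single, hp, hp']
      ext1 x
      ext1
      norm_num
      abel
  · rw [geometricReflection, geometricReflection,
      Module.reflection_mul_reflection_pow (M.simpleCoroot_self i) (M.simpleCoroot_self j) (M i j)]
    set m := M i j with hm
    have hm0 : (m : ℝ) ≠ 0 := by positivity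
    set θ : ℝ := 2 * (Real.pi / m) with hθ
    have ht : M.simpleCoroot i (Finsupp.single j 1) * M.simpleCoroot j (Finsupp.single i 1) - 2
        = 2 * Real.cos θ := by
      simp only [simpleCoroot_single, rootPairing, ← hsymm, ← hm, hθ, Real.cos_two_mul]
      ring
    have hs : Real.sin θ ≠ 0 := by
      apply ne_of_gt
      apply Real.sin_pos_of_pos_of_lt_pi
      · positivity
      · rw [hθ, ← mul_div_assoc, div_lt_iff₀ (by positivity), mul_comm]
        have : (3 : ℝ) ≤ m := by exact_mod_cast h3
        nlinarith [Real.pi_pos]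
    have hS (k : ℤ) : (S ℝ k).eval (2 * Real.cos θ) = Real.sin ((k + 1) * θ) / Real.sin θ := by
      rw [eq_div_iff hs, S_two_mul_real_cos]
    rw [ht]
    rcases Nat.even_or_odd' m with ⟨p, hp | hp⟩
    · have hpp : (S ℝ (p - 1)).eval (2 * Real.cos θ) = 0 := by
        rw [hS]
        have : (((p : ℤ) - 1 : ℤ) + 1 : ℝ) * θ = Real.pi := by
          rw [hθ]; push_cast; field_simp; rw [hp]; push_cast; ring
        rw [this, Real.sin_pi, zero_div]
      have e1 : ((m : ℤ) - 2) / 2 = p - 1 := by omega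
      have e2 : ((m : ℤ) - 1) / 2 = p - 1 := by omega
      rw [e1, e2, hpp]
      simp
    · have hpp : (S ℝ p).eval (2 * Real.cos θ) + (S ℝ (p - 1)).eval (2 * Real.cos θ) = 0 := by
        rw [hS, hS, ← add_div]
        have : Real.sin ((2 * (p : ℤ) + 1) * (θ / 2)) = 0 := by
          have : ((2 * (p : ℤ) + 1 : ℝ)) * (θ / 2) = Real.pi := by
            rw [hθ]; push_cast; field_simp; rw [hp]; push_cast; ring
          rw [this, Real.sin_pi]
        have h := sin_add_sin_eq_zero this
        push_cast at h ⊢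
        rw [sub_add_cancel, h, zero_div]
      have e1 : ((m : ℤ) - 2) / 2 = p - 1 := by omega
      have e2 : ((m : ℤ) - 1) / 2 = p := by omega
      have e3 : ((m : ℤ) - 3) / 2 = p - 1 := by omega
      have e4 : (m : ℤ) / 2 = p := by omega
      rw [e1, e2, e3, e4, hpp]
      simp

end CoxeterMatrix

namespace CoxeterSystem

variable {B W : Type*} [Group W] {M : CoxeterMatrix B} (cs : CoxeterSystem M W)

/-- Distinct indices give distinct simple reflections: they act differently in the geometric
representation. -/
theorem simple_injective : Function.Injective cs.simple := by
  intro i j hij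
  have hl : M.IsLiftable M.geometricReflection := M.geometricReflection_pow
  have h := congrArg (cs.lift ⟨M.geometricReflection, hl⟩) hij
  rw [cs.lift_apply_simple hl, cs.lift_apply_simple hl] at h
  by_contra hne
  have h1 := congrArg (fun f : (B →₀ ℝ) ≃ₗ[ℝ] (B →₀ ℝ) ↦ f (Finsupp.single i 1) i) h
  simp only [CoxeterMatrix.geometricReflection, Module.reflection_apply,
    M.simpleCoroot_single] at h1
  simp [CoxeterMatrix.rootPairing, hne] at h1

end CoxeterSystem

/-! ### The exchange condition -/

namespace CoxeterSystem

open scoped Classical in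
/-- The `i`-th simple reflection acts on pairs of an element of `W` and a sign (additively, an
element of `ZMod 2`), by conjugation on the first component; the sign changes at `cs.simple i`.
On reflections this is the action on roots, a root being a reflection with a sign. -/
noncomputable def rootStep {B W : Type*} [Group W] {M : CoxeterMatrix B} (cs : CoxeterSystem M W)
    (i : B) : Function.End (W × ZMod 2) :=
  fun p ↦ (cs.simple i * p.1 * cs.simple i, p.2 + if p.1 = cs.simple i then 1 else 0)

variable {B W : Type*} [Group W] {M : CoxeterMatrix B} (cs : CoxeterSystem M W)

local prefix:100 "s" => cs.simple
local prefix:100 "ℓ" => cs.length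
local prefix:100 "π" => cs.wordProd

theorem pow_mul_simple (i j : B) (k : ℕ) :
    ((s i * s j) ^ k)⁻¹ * s j = s j * (s i * s j) ^ k := by
  induction k with
  | zero => simp
  | succ k ih =>
    rw [pow_succ', mul_inv_rev, mul_assoc, mul_inv_rev, cs.inv_simple, cs.inv_simple, mul_assoc,
      ← mul_assoc (s j), ← pow_succ' (s i * s j), pow_succ, ← mul_assoc (s j), ← ih]
    simp only [mul_assoc]

open scoped Classical in
/-- Under `(s i * s j) ^ k` the sign of `t` changes once for each `l < 2 * k` such that
`t = s j * (s i * s j) ^ l`. -/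
theorem rootStep_pow (i j : B) (k : ℕ) (t : W) (e : ZMod 2) :
    ((cs.rootStep i * cs.rootStep j) ^ k) (t, e) =
      ((s i * s j) ^ k * t * ((s i * s j) ^ k)⁻¹,
        e + ∑ l ∈ Finset.range (2 * k), if t = s j * (s i * s j) ^ l then 1 else 0) := by
  induction k with
  | zero => simp; rfl
  | succ k ih =>
    have hstep : ((cs.rootStep i * cs.rootStep j) ^ (k + 1)) (t, e) =
        cs.rootStep i (cs.rootStep j (((cs.rootStep i * cs.rootStep j) ^ k) (t, e))) := by
      rw [pow_succ']
      rfl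
    rw [hstep, ih]
    set r := s i * s j with hr
    have h1 : (r ^ k * t * (r ^ k)⁻¹ = s j) ↔ t = s j * r ^ (2 * k) := by
      have : t = (r ^ k)⁻¹ * s j * r ^ k ↔ t = s j * r ^ (2 * k) := by
        rw [cs.pow_mul_simple, mul_assoc, ← pow_add, two_mul]
      rw [← this]
      constructor
      · intro h; rw [← h]; group
      · intro h; rw [h]; group
    have h2 : (s j * (r ^ k * t * (r ^ k)⁻¹) * s j = s i) ↔ t = s j * r ^ (2 * k + 1) := by
      have : t = (r ^ k)⁻¹ * (s j * s i * s j) * r ^ k ↔ t = s j * r ^ (2 * k + 1) := by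
        rw [← mul_assoc, ← mul_assoc, cs.pow_mul_simple, mul_assoc (s j * r ^ k), ← hr,
          mul_assoc (s j), ← pow_succ, mul_assoc, ← pow_add]
        ring_nf
      rw [← this]
      constructor
      · intro h
        rw [← h]
        simp [mul_assoc]
      · intro h
        rw [h]
        simp [mul_assoc]
    rw [show 2 * (k + 1) = 2 * k + 1 + 1 by ring, Finset.sum_range_succ, Finset.sum_range_succ]
    simp only [rootStep, h1, h2]
    refine Prod.ext ?_ ?_
    · have h3 : r⁻¹ = s j * s i := by rw [hr, mul_inv_rev, cs.inv_simple, cs.inv_simple]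
      simp only [pow_succ' r k, mul_inv_rev, h3]
      simp only [hr, mul_assoc]
    · simp only [add_assoc]

theorem rootStep_isLiftable : M.IsLiftable cs.rootStep := by
  classical
  intro i j
  funext p
  obtain ⟨t, e⟩ := p
  rw [cs.rootStep_pow, cs.simple_mul_simple_pow, two_mul, Finset.sum_range_add]
  simp only [pow_add, cs.simple_mul_simple_pow, one_mul]
  rw [← two_mul, show (2 : ZMod 2) = 0 from rfl]
  simp; rfl

/-- The action of `W` on signed elements generated by the maps `rootStep`. -/
noncomputable def rootAction : W →* Function.End (W × ZMod 2) :=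
  cs.lift ⟨cs.rootStep, cs.rootStep_isLiftable⟩

/-- The parity of the number of occurrences of `t` in the right inversion sequence of a word for
`w`; it does not depend on the word. -/
noncomputable def inversionParity (w t : W) : ZMod 2 := (cs.rootAction w (t, 0)).2

theorem rootAction_simple_mul (i : B) (w : W) (p : W × ZMod 2) :
    cs.rootAction (s i * w) p = cs.rootStep i (cs.rootAction w p) := by
  rw [map_mul, rootAction, cs.lift_apply_simple cs.rootStep_isLiftable]
  rfl

theorem rootAction_apply (w t : W) (e : ZMod 2) :
    cs.rootAction w (t, e) = (w * t * w⁻¹, e + cs.inversionParity w t) := by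
  unfold inversionParity
  induction w using cs.simple_induction_left generalizing e with
  | one =>
    rw [map_one]
    change (t, e) = (1 * t * 1⁻¹, e + 0)
    simp
  | mul_simple_left w i ih =>
    rw [rootAction_simple_mul, rootAction_simple_mul, ih, ih 0]
    simp [rootStep, mul_assoc, add_assoc]

theorem inversionParity_one (t : W) : cs.inversionParity 1 t = 0 := by
  rw [inversionParity, map_one]
  rfl

open scoped Classical in
theorem inversionParity_simple_mul (i : B) (w t : W) :
    cs.inversionParity (s i * w) t =
      cs.inversionParity w t + if w * t * w⁻¹ = s i then 1 else 0 := by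
  rw [inversionParity, rootAction_simple_mul, rootAction_apply]
  simp [rootStep]

theorem inversionParity_mul (v w t : W) :
    cs.inversionParity (v * w) t =
      cs.inversionParity w t + cs.inversionParity v (w * t * w⁻¹) := by
  have h : cs.rootAction (v * w) (t, 0) = cs.rootAction v (cs.rootAction w (t, 0)) := by
    rw [map_mul]
    rfl
  rw [inversionParity, h, rootAction_apply, rootAction_apply, zero_add]

theorem mem_rightInvSeq_of_inversionParity_ne_zero {ω : List B} {t : W}
    (h : cs.inversionParity (π ω) t ≠ 0) : t ∈ cs.rightInvSeq ω := by
  induction ω with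
  | nil => simp [inversionParity_one] at h
  | cons i ω ih =>
    rw [wordProd_cons, inversionParity_simple_mul] at h
    rw [rightInvSeq, List.mem_cons]
    by_cases hi : π ω * t * (π ω)⁻¹ = s i
    · left
      rw [← hi]
      group
    · rw [if_neg hi, add_zero] at h
      exact Or.inr (ih h)

theorem length_mul_simple_lt_iff (w : W) (i : B) :
    ℓ (w * s i) < ℓ w ↔ cs.inversionParity w (s i) ≠ 0 := by
  have key (w : W) (h : cs.inversionParity w (s i) ≠ 0) : ℓ (w * s i) < ℓ w := by
    obtain ⟨ω, hω, rfl⟩ := cs.exists_isReduced w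
    exact (cs.isRightInversion_of_mem_rightInvSeq hω
      (cs.mem_rightInvSeq_of_inversionParity_ne_zero h)).2
  refine ⟨fun h h0 ↦ ?_, key w⟩
  have h1 := key (w * s i) (by
    have h2 : cs.inversionParity (s i) (s i) = 1 := by
      have := cs.inversionParity_simple_mul i 1 (s i)
      simpa [inversionParity_one] using this
    rw [inversionParity_mul, h2]
    simp [h0])
  rw [cs.simple_mul_simple_cancel_right] at h1
  omega

/-- The exchange condition. -/
theorem exists_wordProd_mul_simple_eq_eraseIdx {ω : List B} {i : B}
    (h : ℓ (π ω * s i) < ℓ (π ω)) : ∃ j < ω.length, π ω * s i = π (ω.eraseIdx j) := by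
  have hm := cs.mem_rightInvSeq_of_inversionParity_ne_zero
    ((cs.length_mul_simple_lt_iff _ i).1 h)
  obtain ⟨j, hj, hji⟩ := List.getElem_of_mem hm
  refine ⟨j, by simpa using hj, ?_⟩
  rw [← cs.wordProd_mul_getD_rightInvSeq, List.getD_eq_getElem _ _ hj, hji]

/-- The folding condition: if `s i` and `s j` both lengthen `w` but do not lengthen it together,
then `s i * w = w * s j`. -/
theorem simple_mul_eq_mul_simple {w : W} {i j : B} (hj : ℓ w < ℓ (w * s j))
    (hij : ¬ ℓ (s i * w) < ℓ (s i * w * s j)) : s i * w = w * s j := by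
  have h1 : cs.inversionParity w (s j) = 0 := by
    by_contra h
    have := (cs.length_mul_simple_lt_iff w j).2 h
    omega
  have h2 := (cs.length_mul_simple_lt_iff (s i * w) j).1 (by
    have := cs.length_mul_simple_ne (s i * w) j
    omega)
  rw [inversionParity_simple_mul, h1, zero_add] at h2
  have h3 : w * s j * w⁻¹ = s i := by
    by_contra h
    simp [h] at h2
  rw [← h3]
  group

end CoxeterSystem

/-! ### Standard parabolic subgroups -/

namespace CoxeterSystem

variable {B W : Type*} [Group W] {M : CoxeterMatrix B} (cs : CoxeterSystem M W)

local prefix:100 "s" => cs.simple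
local prefix:100 "ℓ" => cs.length
local prefix:100 "π" => cs.wordProd

/-- The standard parabolic subgroup generated by the simple reflections with index in `I`. -/
def parabolic (I : Set B) : Subgroup W := Subgroup.closure (cs.simple '' I)

/-- The element `v` has no left descent in `I`: it is the shortest element of its right coset
`cs.parabolic I * v`. -/
def IsLeftReduced (I : Set B) (v : W) : Prop := ∀ i ∈ I, ℓ v < ℓ (s i * v)

variable {I J : Set B}

theorem simple_mem_parabolic {i : B} (hi : i ∈ I) : s i ∈ cs.parabolic I :=
  Subgroup.subset_closure ⟨i, hi, rfl⟩

theorem parabolic_mono (h : I ⊆ J) : cs.parabolic I ≤ cs.parabolic J :=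
  Subgroup.closure_mono (Set.image_mono h)

theorem parabolic_univ : cs.parabolic Set.univ = ⊤ := by
  rw [parabolic, Set.image_univ, cs.subgroup_closure_range_simple]

theorem wordProd_mem_parabolic {ω : List B} (h : ∀ i ∈ ω, i ∈ I) : π ω ∈ cs.parabolic I := by
  induction ω with
  | nil => simp [one_mem]
  | cons i ω ih =>
    rw [wordProd_cons]
    exact mul_mem (cs.simple_mem_parabolic (h i (by simp))) (ih fun j hj ↦ h j (by simp [hj]))

/-- An element of a standard parabolic subgroup has a reduced word in the generators of this
subgroup: multiplying a reduced word by a generator either extends it or, by the exchange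
condition, deletes one of its letters. -/
theorem exists_isReduced_of_mem_parabolic {u : W} (hu : u ∈ cs.parabolic I) :
    ∃ ω : List B, (∀ i ∈ ω, i ∈ I) ∧ cs.IsReduced ω ∧ u = π ω := by
  have step (w : W) (j : B) (hj : j ∈ I)
      (h : ∃ ω : List B, (∀ i ∈ ω, i ∈ I) ∧ cs.IsReduced ω ∧ w = π ω) :
      ∃ ω : List B, (∀ i ∈ ω, i ∈ I) ∧ cs.IsReduced ω ∧ w * s j = π ω := by
    obtain ⟨ω, hI, hω, rfl⟩ := h
    rcases cs.length_mul_simple (π ω) j with h1 | h1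
    · refine ⟨ω.concat j, ?_, ?_, (cs.wordProd_concat j ω).symm⟩
      · intro i hi
        simp only [List.concat_eq_append, List.mem_append, List.mem_singleton] at hi
        rcases hi with hi | rfl
        exacts [hI i hi, hj]
      · rw [IsReduced, wordProd_concat, h1, hω.eq]
        simp
    · obtain ⟨k, hk, he⟩ := cs.exists_wordProd_mul_simple_eq_eraseIdx
        (show ℓ (π ω * s j) < ℓ (π ω) by omega)
      refine ⟨ω.eraseIdx k, fun i hi ↦ hI i (List.mem_of_mem_eraseIdx hi), ?_, he⟩
      rw [IsReduced, ← he, List.length_eraseIdx_of_lt hk, ← hω.eq]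
      omega
  induction hu using Subgroup.closure_induction_right with
  | one => exact ⟨[], by simp, by simp [IsReduced], by simp⟩
  | mul_right w hw y hy ih =>
    obtain ⟨j, hj, rfl⟩ := hy
    exact step w j hj ih
  | mul_inv_cancel w hw y hy ih =>
    obtain ⟨j, hj, rfl⟩ := hy
    rw [cs.inv_simple]
    exact step w j hj ih

theorem parabolic_induction_left {p : W → Prop} (one : p 1)
    (mul : ∀ i ∈ I, ∀ w ∈ cs.parabolic I, ℓ w < ℓ (s i * w) → p w → p (s i * w))
    {u : W} (hu : u ∈ cs.parabolic I) : p u := by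
  obtain ⟨ω, hI, hω, rfl⟩ := cs.exists_isReduced_of_mem_parabolic hu
  clear hu
  induction ω with
  | nil => simpa using one
  | cons i ω ih =>
    have hω' : cs.IsReduced ω := by simpa using hω.drop 1
    have hI' : ∀ j ∈ ω, j ∈ I := fun j hj ↦ hI j (by simp [hj])
    have h := hω.eq
    rw [wordProd_cons] at h ⊢
    refine mul i (hI i (by simp)) _ (cs.wordProd_mem_parabolic hI') ?_ (ih hI' hω')
    rw [h, hω'.eq]
    simp

theorem length_inv_mul_simple (w : W) (i : B) : ℓ (w⁻¹ * s i) = ℓ (s i * w) := by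
  rw [← cs.length_inv, mul_inv_rev, inv_inv, cs.inv_simple]

theorem parabolic_induction_right {p : W → Prop} (one : p 1)
    (mul : ∀ i ∈ I, ∀ w ∈ cs.parabolic I, ℓ w < ℓ (w * s i) → p w → p (w * s i))
    {u : W} (hu : u ∈ cs.parabolic I) : p u := by
  rw [← inv_inv u]
  refine cs.parabolic_induction_left (p := fun w ↦ p w⁻¹) (by simpa using one) ?_ (inv_mem hu)
  intro i hi w hw h1 h2
  rw [mul_inv_rev, cs.inv_simple]
  refine mul i hi _ (inv_mem hw) ?_ h2
  rwa [cs.length_inv, cs.length_inv_mul_simple]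

theorem simple_mem_parabolic_iff {i : B} : s i ∈ cs.parabolic I ↔ i ∈ I := by
  refine ⟨fun h ↦ ?_, cs.simple_mem_parabolic⟩
  obtain ⟨ω, hI, hω, he⟩ := cs.exists_isReduced_of_mem_parabolic h
  have h1 := hω.eq
  rw [← he, cs.length_simple] at h1
  obtain ⟨j, rfl⟩ := List.length_eq_one_iff.1 h1.symm
  rw [wordProd_singleton] at he
  rw [cs.simple_injective he]
  exact hI j (by simp)

theorem mem_of_length_mul_simple_lt {u : W} (hu : u ∈ cs.parabolic I) {i : B}
    (h : ℓ (u * s i) < ℓ u) : i ∈ I := by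
  obtain ⟨ω, hI, hω, rfl⟩ := cs.exists_isReduced_of_mem_parabolic hu
  obtain ⟨k, hk, he⟩ := cs.exists_wordProd_mul_simple_eq_eraseIdx h
  rw [← cs.simple_mem_parabolic_iff]
  have h1 : π (ω.eraseIdx k) ∈ cs.parabolic I :=
    cs.wordProd_mem_parabolic fun i hi ↦ hI i (List.mem_of_mem_eraseIdx hi)
  rw [← he] at h1
  exact (Subgroup.mul_mem_cancel_left _ hu).1 h1

theorem mem_of_length_simple_mul_lt {u : W} (hu : u ∈ cs.parabolic I) {i : B}
    (h : ℓ (s i * u) < ℓ u) : i ∈ I :=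
  cs.mem_of_length_mul_simple_lt (inv_mem hu)
    (by rwa [cs.length_inv, cs.length_inv_mul_simple])

theorem lt_length_simple_mul {w : W} {i : B} (h : ¬ ℓ (s i * w) < ℓ w) : ℓ w < ℓ (s i * w) := by
  have := cs.length_simple_mul_ne w i
  omega

/-- A standard parabolic subgroup is the intersection of the maximal ones containing it. -/
theorem mem_parabolic_of_forall {u : W} (h : ∀ k ∉ I, u ∈ cs.parabolic {k}ᶜ) :
    u ∈ cs.parabolic I := by
  induction hn : ℓ u using Nat.strong_induction_on generalizing u with
  | _ n ih =>
    by_cases hu : u = 1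
    · rw [hu]; exact one_mem _
    · obtain ⟨i, hi⟩ := cs.exists_leftDescent_of_ne_one hu
      rw [IsLeftDescent] at hi
      have hiI : i ∈ I := by
        by_contra hiI
        exact cs.mem_of_length_simple_mul_lt (h i hiI) hi rfl
      have h1 : s i * u ∈ cs.parabolic I := by
        refine ih _ (hn ▸ hi) (fun k hk ↦ mul_mem (cs.simple_mem_parabolic ?_) (h k hk)) rfl
        rintro rfl
        exact hk hiI
      exact (Subgroup.mul_mem_cancel_left _ (cs.simple_mem_parabolic hiI)).1 h1

theorem mem_parabolic_singleton {i : B} {u : W} (hu : u ∈ cs.parabolic {i}) :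
    u = 1 ∨ u = s i := by
  refine cs.parabolic_induction_left (p := fun u ↦ u = 1 ∨ u = s i) (Or.inl rfl) ?_ hu
  rintro j rfl w - h (rfl | rfl)
  · right; simp
  · left; simp

theorem mem_parabolic_empty {u : W} : u ∈ cs.parabolic ∅ ↔ u = 1 := by
  simp [parabolic]

/-! ### Coset representatives -/

theorem exists_mul_isLeftReduced (I : Set B) (w : W) :
    ∃ u ∈ cs.parabolic I, ∃ v, cs.IsLeftReduced I v ∧ w = u * v := by
  induction hn : ℓ w using Nat.strong_induction_on generalizing w with
  | _ n ih =>
    by_cases h : cs.IsLeftReduced I w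
    · exact ⟨1, one_mem _, w, h, by simp⟩
    · simp only [IsLeftReduced, not_forall] at h
      obtain ⟨i, hi, h⟩ := h
      have h1 : ℓ (s i * w) < ℓ w := by
        have := cs.length_simple_mul_ne w i
        omega
      obtain ⟨u, hu, v, hv, he⟩ := ih _ (hn ▸ h1) (s i * w) rfl
      refine ⟨s i * u, mul_mem (cs.simple_mem_parabolic hi) hu, v, hv, ?_⟩
      rw [mul_assoc, ← he, cs.simple_mul_simple_cancel_left]

variable {cs} in
theorem IsLeftReduced.mono {v : W} (hv : cs.IsLeftReduced J v) (h : I ⊆ J) :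
    cs.IsLeftReduced I v := fun i hi ↦ hv i (h hi)

variable {cs} in
/-- A prefix of a left reduced element is left reduced. -/
theorem IsLeftReduced.of_mul_simple {v : W} {j : B} (hv : cs.IsLeftReduced I (v * s j))
    (h : ℓ v < ℓ (v * s j)) : cs.IsLeftReduced I v := by
  intro i hi
  apply cs.lt_length_simple_mul
  intro h1
  have h2 := hv i hi
  rw [← mul_assoc] at h2
  have h3 := cs.length_mul_simple (s i * v) j
  omega

/-- Lengths add up in the decomposition of an element along a standard parabolic subgroup. -/
theorem length_mul_of_isLeftReduced {u v : W} (hu : u ∈ cs.parabolic I)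
    (hv : cs.IsLeftReduced I v) : ℓ (u * v) = ℓ u + ℓ v := by
  induction hn : ℓ v generalizing u v with
  | zero =>
    rw [cs.length_eq_zero_iff] at hn
    simp [hn]
  | succ n ih =>
    have hv1 : v ≠ 1 := by
      rintro rfl
      simp at hn
    obtain ⟨j, hj⟩ := cs.exists_rightDescent_of_ne_one hv1
    rw [IsRightDescent] at hj
    obtain ⟨v', rfl⟩ : ∃ v', v = v' * s j := ⟨v * s j, by simp⟩
    rw [cs.simple_mul_simple_cancel_right] at hj
    have hv' := hv.of_mul_simple hj
    have hn' : ℓ v' = n := by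
      have := cs.length_mul_simple v' j
      omega
    have ih' {u : W} (hu : u ∈ cs.parabolic I) := ih hu hv' hn'
    refine cs.parabolic_induction_left (I := I)
      (p := fun u ↦ ℓ (u * (v' * s j)) = ℓ u + (n + 1)) (by simp [hn]) ?_ hu
    intro i hi u hu h1 h2
    have hsu := ih' (mul_mem (cs.simple_mem_parabolic hi) hu)
    have hu' := ih' hu
    rw [← mul_assoc] at h2 ⊢
    rcases cs.length_mul_simple (s i * u * v') j with h3 | h3
    · omega
    -- Otherwise folding gives `v' * s j = u' * v'` with `u'` in the parabolic subgroup, so that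
    -- `u'` is a simple reflection by length, against `v' * s j` being left reduced.
    · exfalso
      have h4 : s i * (u * v') = u * v' * s j := by
        refine cs.simple_mul_eq_mul_simple (by omega) ?_
        rw [← mul_assoc]
        omega
      have h5 : v' * s j = (u⁻¹ * s i * u) * v' := by
        have : v' * s j = u⁻¹ * (u * v' * s j) := by group
        rw [this, ← h4]
        group
      have h6 : u⁻¹ * s i * u ∈ cs.parabolic I :=
        mul_mem (mul_mem (inv_mem hu) (cs.simple_mem_parabolic hi)) hu
      have h7 := ih' h6
      rw [← h5, hn] at h7
      obtain ⟨k, hk⟩ := cs.length_eq_one_iff.1 (show ℓ (u⁻¹ * s i * u) = 1 by omega)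
      rw [hk] at h5 h6
      have h8 := hv k (cs.simple_mem_parabolic_iff.1 h6)
      rw [h5, cs.simple_mul_simple_cancel_left] at h8
      rw [← h5] at h8
      omega

theorem eq_of_mul_eq_mul_of_isLeftReduced {u v u' v' : W} (hu : u ∈ cs.parabolic I)
    (hu' : u' ∈ cs.parabolic I) (hv : cs.IsLeftReduced I v) (hv' : cs.IsLeftReduced I v')
    (h : u * v = u' * v') : u = u' ∧ v = v' := by
  have h1 : v = (u⁻¹ * u') * v' := by rw [mul_assoc, ← h]; group
  have h2 : v' = (u'⁻¹ * u) * v := by rw [mul_assoc, h]; group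
  have h3 := cs.length_mul_of_isLeftReduced (mul_mem (inv_mem hu) hu') hv'
  have h4 := cs.length_mul_of_isLeftReduced (mul_mem (inv_mem hu') hu) hv
  rw [← h1] at h3
  rw [← h2] at h4
  have h5 : u⁻¹ * u' = 1 := cs.length_eq_zero_iff.1 (by omega)
  have h6 : u = u' := inv_mul_eq_one.1 h5
  exact ⟨h6, by simpa [h6] using h⟩

/-- Multiplying a left reduced element on the right by a simple reflection gives a left reduced
element or does not change the coset. -/
theorem isLeftReduced_mul_simple_or {v : W} (hv : cs.IsLeftReduced I v) (j : B) :
    cs.IsLeftReduced I (v * s j) ∨ ∃ i ∈ I, v * s j = s i * v := by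
  by_cases h : cs.IsLeftReduced I (v * s j)
  · exact Or.inl h
  right
  simp only [IsLeftReduced, not_forall] at h
  obtain ⟨i, hi, h⟩ := h
  have h1 := hv i hi
  have h2 := cs.length_mul_simple (s i * v) j
  have h3 := cs.length_mul_simple_ne v j
  have h4 := cs.length_simple_mul v i
  have h5 := cs.length_mul_simple v j
  rw [← mul_assoc] at h
  exact ⟨i, hi, (cs.simple_mul_eq_mul_simple (by
    have := cs.length_simple_mul_ne (v * s j) i
    rw [← mul_assoc] at this
    omega) (by omega)).symm⟩

/-- If the wall of `s i` separates two chambers of the residue `x * cs.parabolic J`, then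
`s i` stabilizes this residue. -/
theorem conj_mem_parabolic_of_length_lt {x v : W} {i : B} (hv : v ∈ cs.parabolic J)
    (h1 : ℓ x < ℓ (s i * x)) (h2 : ¬ ℓ (x * v) < ℓ (s i * (x * v))) :
    x⁻¹ * s i * x ∈ cs.parabolic J := by
  revert h2
  rw [imp_iff_not_or, not_not]
  refine cs.parabolic_induction_right (I := J)
    (p := fun v ↦ ℓ (x * v) < ℓ (s i * (x * v)) ∨ x⁻¹ * s i * x ∈ cs.parabolic J)
    (by simp [h1]) ?_ hv
  rintro j hj v hv - (h | h)
  · by_cases h3 : ℓ (x * v) < ℓ (x * v * s j)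
    · by_cases h4 : ℓ (s i * (x * v)) < ℓ (s i * (x * v) * s j)
      · left
        have h5 := cs.length_mul_simple (x * v) j
        rw [← mul_assoc x, ← mul_assoc (s i)]
        omega
      · right
        have h5 := cs.simple_mul_eq_mul_simple h3 h4
        have h6 : x⁻¹ * s i * x = v * s j * v⁻¹ := by
          have : x⁻¹ * s i * x = x⁻¹ * (s i * (x * v)) * v⁻¹ := by group
          rw [this, h5]
          group
        rw [h6]
        exact mul_mem (mul_mem hv (cs.simple_mem_parabolic hj)) (inv_mem hv)
    · left
      have h5 := cs.length_mul_simple (x * v) j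
      have h6 := cs.length_mul_simple (s i * (x * v)) j
      rw [← mul_assoc x, ← mul_assoc (s i)]
      omega
  · exact Or.inr h

end CoxeterSystem

/-! ### Transporters between standard parabolic subgroups -/

namespace CoxeterSystem

variable {B W : Type*} [Group W] {M : CoxeterMatrix B} (cs : CoxeterSystem M W)

local prefix:100 "s" => cs.simple
local prefix:100 "ℓ" => cs.length
local prefix:100 "π" => cs.wordProd

variable {I J K : Set B}

theorem conj_mem_of_mem_parabolic {H : Subgroup W} {g u : W}
    (h : ∀ i ∈ I, g⁻¹ * s i * g ∈ H) (hu : u ∈ cs.parabolic I) : g⁻¹ * u * g ∈ H := by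
  refine cs.parabolic_induction_left (p := fun u ↦ g⁻¹ * u * g ∈ H) (by simp [one_mem]) ?_ hu
  intro i hi w _ _ hw
  have : g⁻¹ * (s i * w) * g = (g⁻¹ * s i * g) * (g⁻¹ * w * g) := by group
  rw [this]
  exact mul_mem (h i hi) hw

/-- The projections of the chambers of the residue `g * cs.parabolic K` to the residue
`cs.parabolic J` all lie in the residue of type `{j ∈ J | g⁻¹ * s j * g ∈ cs.parabolic K}` of `1`,
if `1` itself is the projection of `g`. -/
theorem exists_mul_eq_mul_isLeftReduced {g v : W} (hg : cs.IsLeftReduced J g)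
    (hv : v ∈ cs.parabolic K) :
    ∃ q ∈ cs.parabolic {j ∈ J | g⁻¹ * s j * g ∈ cs.parabolic K},
      ∃ r, cs.IsLeftReduced J r ∧ g * v = q * r := by
  set P := {j ∈ J | g⁻¹ * s j * g ∈ cs.parabolic K} with hP
  refine cs.parabolic_induction_right (I := K)
    (p := fun v ↦ ∃ q ∈ cs.parabolic P, ∃ r, cs.IsLeftReduced J r ∧ g * v = q * r)
    ⟨1, one_mem _, g, hg, by simp⟩ ?_ hv
  rintro k hk v hv - ⟨q, hq, r, hr, he⟩
  rcases cs.isLeftReduced_mul_simple_or hr k with h | ⟨j, hj, h⟩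
  · exact ⟨q, hq, r * s k, h, by rw [← mul_assoc, he, mul_assoc]⟩
  · have hjP : j ∈ P := by
      refine ⟨hj, ?_⟩
      have h1 : g⁻¹ * q * g ∈ cs.parabolic K :=
        cs.conj_mem_of_mem_parabolic (fun i hi ↦ hi.2) hq
      have h2 : s j = r * s k * r⁻¹ := by rw [h]; group
      have h3 : r = q⁻¹ * (g * v) := by rw [he]; group
      have h4 : g⁻¹ * s j * g =
          (g⁻¹ * q * g)⁻¹ * (v * s k * v⁻¹) * (g⁻¹ * q * g) := by
        rw [h2, h3]; group
      rw [h4]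
      exact mul_mem (mul_mem (inv_mem h1) (mul_mem (mul_mem hv (cs.simple_mem_parabolic hk))
        (inv_mem hv))) h1
    exact ⟨q * s j, mul_mem hq (cs.simple_mem_parabolic hjP), r, hr, by
      rw [← mul_assoc, he, mul_assoc, h, ← mul_assoc]⟩

/-- The element `x` is left reduced with respect to `I` and conjugates the simple reflections in
`I` to simple reflections. Geometrically, `x` is the projection of the chamber `1` to a simplex
which lies on the same walls as the face of type `Iᶜ` of `1`. -/
def IsTransporter (I : Set B) (x : W) : Prop :=
  cs.IsLeftReduced I x ∧ ∀ i ∈ I, ∃ j, s i * x = x * s j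

/-- The indices `j` of the simple reflections of the form `x⁻¹ * s i * x` with `i ∈ I`. -/
def transport (I : Set B) (x : W) : Set B := {j | ∃ i ∈ I, s i * x = x * s j}

theorem transport_one : cs.transport I 1 = I := by
  ext j
  constructor
  · rintro ⟨i, hi, h⟩
    rw [mul_one, one_mul] at h
    rwa [← cs.simple_injective h]
  · exact fun hj ↦ ⟨j, hj, by simp⟩

theorem transport_subset {x : W} (hx : x ∈ cs.parabolic J) (hI : I ⊆ J) :
    cs.transport I x ⊆ J := by
  rintro j ⟨i, hi, h⟩
  rw [← cs.simple_mem_parabolic_iff]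
  have : s j = x⁻¹ * (s i * x) := by rw [h]; group
  rw [this]
  exact mul_mem (inv_mem hx) (mul_mem (cs.simple_mem_parabolic (hI hi)) hx)

variable {cs} in
theorem IsTransporter.ncard_transport {x : W} (hx : cs.IsTransporter I x) :
    (cs.transport I x).ncard = I.ncard := by
  choose! f hf using hx.2
  have himg : cs.transport I x = f '' I := by
    ext j
    constructor
    · rintro ⟨i, hi, h⟩
      refine ⟨i, hi, ?_⟩
      rw [hf i hi] at h
      exact cs.simple_injective (mul_left_cancel h)
    · rintro ⟨i, hi, rfl⟩
      exact ⟨i, hi, hf i hi⟩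
  rw [himg]
  refine Set.InjOn.ncard_image fun i hi j hj hij ↦ ?_
  refine cs.simple_injective (mul_right_cancel (b := x) ?_)
  rw [hf i hi, hf j hj, hij]

variable {cs} in
/-- Moving an element of the parabolic subgroup across a transporter does not lengthen it. -/
theorem IsTransporter.exists_mul_eq_mul {u x : W} (hx : cs.IsTransporter I x)
    (hu : u ∈ cs.parabolic I) : ∃ u', u * x = x * u' ∧ ℓ u' ≤ ℓ u := by
  refine cs.parabolic_induction_left (I := I)
    (p := fun u ↦ ∃ u', u * x = x * u' ∧ ℓ u' ≤ ℓ u) ⟨1, by simp⟩ ?_ hu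
  rintro i hi w - h ⟨u', h1, h2⟩
  obtain ⟨j, hj⟩ := hx.2 i hi
  refine ⟨s j * u', by rw [mul_assoc, h1, ← mul_assoc, hj, mul_assoc], ?_⟩
  have := cs.length_simple_mul u' j
  omega

/-! ### Uniqueness of transporters -/

/-- The left action of a simple reflection in the Coxeter monoid (the `0`-Hecke monoid). -/
noncomputable def leftStar (i : B) (w : W) : W := if ℓ w < ℓ (s i * w) then s i * w else w

/-- The right action of a simple reflection in the Coxeter monoid (the `0`-Hecke monoid). -/
noncomputable def rightStar (j : B) (w : W) : W := if ℓ w < ℓ (w * s j) then w * s j else w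

theorem leftStar_rightStar_comm (i j : B) (w : W) :
    cs.leftStar i (cs.rightStar j w) = cs.rightStar j (cs.leftStar i w) := by
  have h1 := cs.length_simple_mul w i
  have h2 := cs.length_mul_simple w j
  have h3 := cs.length_simple_mul (w * s j) i
  have h4 := cs.length_mul_simple (s i * w) j
  have h5 : s i * (w * s j) = s i * w * s j := (mul_assoc _ _ _).symm
  rw [h5] at h3
  unfold leftStar rightStar
  by_cases ha : ℓ w < ℓ (s i * w) <;> by_cases hb : ℓ w < ℓ (w * s j)
  · rw [if_pos ha, if_pos hb, h5]
    by_cases hc : ℓ (s i * w) < ℓ (s i * w * s j)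
    · rw [if_pos hc, if_pos (by omega)]
    · rw [if_neg hc, if_neg (by omega), cs.simple_mul_eq_mul_simple hb hc]
  · rw [if_pos ha, if_neg hb, if_pos ha, if_neg (by omega)]
  · rw [if_neg ha, if_pos hb, h5, if_neg (by omega)]
  · rw [if_neg ha, if_neg hb, if_neg ha]

/-- In the rank `|I| + 1` parabolic subgroup generated by `I` and `k`, every left reduced element
is at most as long as a nontrivial transporter `u`, with equality only for `u` itself. In the
Coxeter monoid, the product `v * u` lies in the coset `cs.parabolic I * u`, because `k` is a left
descent of each element of this coset; on the other hand, this product has `v` as a prefix, and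
extending an element to the right does not shorten the left reduced representative of its
coset. -/
theorem IsTransporter.length_le {k : B} {u v : W} (hu : cs.IsTransporter I u)
    (hu1 : u ≠ 1) (huJ : u ∈ cs.parabolic (insert k I)) (hv : cs.IsLeftReduced I v)
    (hvJ : v ∈ cs.parabolic (insert k I)) : ℓ v ≤ ℓ u ∧ (ℓ u = ℓ v → u = v) := by
  have hk : ℓ (s k * u) < ℓ u := by
    obtain ⟨i, hi⟩ := cs.exists_leftDescent_of_ne_one hu1
    rw [IsLeftDescent] at hi
    rcases cs.mem_of_length_simple_mul_lt huJ hi with rfl | hiI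
    · exact hi
    · have := hu.1 i hiI
      omega
  have hkx {x : W} (hx : x ∈ cs.parabolic I) : ℓ (s k * (x * u)) < ℓ (x * u) := by
    obtain ⟨x', h1, h2⟩ := hu.exists_mul_eq_mul hx
    rw [cs.length_mul_of_isLeftReduced hx hu.1, h1, ← mul_assoc]
    have := cs.length_mul_le (s k * u) x'
    omega
  -- The map `f` is left multiplication by `v` in the Coxeter monoid.
  obtain ⟨f, hf1, hfR, hfu⟩ : ∃ f : W → W, f 1 = v ∧
      (∀ j w, f (cs.rightStar j w) = cs.rightStar j (f w)) ∧
      (∀ w, (∃ x ∈ cs.parabolic I, w = x * u) → ∃ x ∈ cs.parabolic I, f w = x * u) := by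
    refine cs.parabolic_induction_left (I := insert k I) (p := fun v ↦ ∃ f : W → W, f 1 = v ∧
      (∀ j w, f (cs.rightStar j w) = cs.rightStar j (f w)) ∧
      (∀ w, (∃ x ∈ cs.parabolic I, w = x * u) → ∃ x ∈ cs.parabolic I, f w = x * u))
      ⟨id, rfl, fun _ _ ↦ rfl, fun _ h ↦ h⟩ ?_ hvJ
    rintro i hi w - hlt ⟨f, h1, h2, h3⟩
    refine ⟨fun w ↦ cs.leftStar i (f w), ?_, ?_, ?_⟩
    · simp only [h1, leftStar]
      rw [if_pos hlt]
    · intro j w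
      simp only [h2, cs.leftStar_rightStar_comm]
    · intro w hw
      obtain ⟨x, hx, he⟩ := h3 w hw
      simp only [he, leftStar]
      split_ifs with hlt
      · rcases hi with rfl | hi
        · have := hkx hx
          omega
        · exact ⟨s i * x, mul_mem (cs.simple_mem_parabolic hi) hx, by rw [mul_assoc]⟩
      · exact ⟨x, hx, rfl⟩
  have hQ (w : W) : ∃ x ∈ cs.parabolic I, ∃ y, cs.IsLeftReduced I y ∧ f w = x * y ∧
      ℓ v ≤ ℓ y ∧ (ℓ y = ℓ v → y = v) := by
    have hw : w ∈ cs.parabolic Set.univ := by rw [cs.parabolic_univ]; trivial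
    refine cs.parabolic_induction_right (p := fun w ↦ ∃ x ∈ cs.parabolic I, ∃ y,
      cs.IsLeftReduced I y ∧ f w = x * y ∧ ℓ v ≤ ℓ y ∧ (ℓ y = ℓ v → y = v))
      ⟨1, one_mem _, v, hv, by simp [hf1], le_rfl, fun _ ↦ rfl⟩ ?_ hw
    rintro j - w - hlt ⟨x, hx, y, hy, he, hle, heq⟩
    have h1 : w * s j = cs.rightStar j w := by rw [rightStar, if_pos hlt]
    rw [h1, hfR, rightStar]
    split_ifs with hlt'
    · rw [he] at hlt' ⊢
      rcases cs.isLeftReduced_mul_simple_or hy j with h | ⟨i, hi, h⟩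
      · have h2 := cs.length_mul_of_isLeftReduced hx hy
        have h3 := cs.length_mul_of_isLeftReduced hx h
        rw [← mul_assoc] at h3
        exact ⟨x, hx, y * s j, h, by rw [mul_assoc], by omega, fun h4 ↦ by omega⟩
      · exact ⟨x * s i, mul_mem hx (cs.simple_mem_parabolic hi), y, hy,
          by rw [mul_assoc, h, mul_assoc], hle, heq⟩
    · exact ⟨x, hx, y, hy, he, hle, heq⟩
  obtain ⟨x, hx, y, hy, he, hle, heq⟩ := hQ u
  obtain ⟨x', hx', he'⟩ := hfu u ⟨1, one_mem _, by simp⟩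
  obtain ⟨-, rfl⟩ := cs.eq_of_mul_eq_mul_of_isLeftReduced hx' hx hu.1 hy (he'.symm.trans he)
  exact ⟨hle, heq⟩

/-- A parabolic subgroup of rank one more than `I` contains at most one nontrivial transporter
for `I`. Geometrically, a simplex of codimension one in the intersection of some walls is a face
of at most two simplices of maximal dimension in it. -/
theorem IsTransporter.eq_of_mem_parabolic {k : B} {u v : W} (hu : cs.IsTransporter I u)
    (hv : cs.IsTransporter I v) (hu1 : u ≠ 1) (hv1 : v ≠ 1)
    (huJ : u ∈ cs.parabolic (insert k I)) (hvJ : v ∈ cs.parabolic (insert k I)) : u = v := by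
  have h1 := hu.length_le cs hu1 huJ hv.1 hvJ
  have h2 := hv.length_le cs hv1 hvJ hu.1 huJ
  exact h1.2 (le_antisymm h2.1 h1.1)

/-- Every nontrivial transporter splits off a nontrivial transporter that lies in a parabolic
subgroup of rank one more than `I`. -/
theorem IsTransporter.exists_eq_mul {x : W} (hx : cs.IsTransporter I x) {k : B}
    (hk : ℓ (s k * x) < ℓ x) :
    ∃ u ∈ cs.parabolic (insert k I), ∃ x', cs.IsLeftReduced (insert k I) x' ∧ x = u * x' ∧
      u ≠ 1 ∧ cs.IsTransporter I u ∧ cs.IsTransporter (cs.transport I u) x' ∧ ℓ x' < ℓ x := by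
  obtain ⟨u, hu, x', hx', rfl⟩ := cs.exists_mul_isLeftReduced (insert k I) x
  have hIJ : I ⊆ insert k I := Set.subset_insert _ _
  have hu1 : u ≠ 1 := by
    rintro rfl
    have := hx' k (Set.mem_insert _ _)
    rw [one_mul] at hk
    omega
  have hlen := cs.length_mul_of_isLeftReduced hu hx'
  have hlu : ℓ u ≠ 0 := fun h ↦ hu1 (cs.length_eq_zero_iff.1 h)
  refine ⟨u, hu, x', hx', rfl, hu1, ⟨?_, ?_⟩, ⟨hx'.mono (cs.transport_subset hu hIJ), ?_⟩,
    by omega⟩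
  · intro i hi
    have h1 := hx.1 i hi
    have h2 := cs.length_mul_of_isLeftReduced (mul_mem (cs.simple_mem_parabolic (hIJ hi)) hu) hx'
    rw [← mul_assoc] at h1
    omega
  · intro i hi
    obtain ⟨l, hl⟩ := hx.2 i hi
    rw [← mul_assoc, mul_assoc u] at hl
    rcases cs.isLeftReduced_mul_simple_or hx' l with h | ⟨j, hj, h⟩
    · have h1 := (cs.eq_of_mul_eq_mul_of_isLeftReduced
        (mul_mem (cs.simple_mem_parabolic (hIJ hi)) hu) hu hx' h hl).1
      have h2 := cs.length_simple_mul_ne u i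
      rw [h1] at h2
      exact absurd rfl h2
    · rw [h, ← mul_assoc] at hl
      exact ⟨j, mul_right_cancel hl⟩
  · rintro j ⟨i, hi, h⟩
    obtain ⟨l, hl⟩ := hx.2 i hi
    refine ⟨l, mul_left_cancel (a := u) ?_⟩
    rw [← mul_assoc, ← h, ← mul_assoc u x', ← hl, mul_assoc]

theorem transport_transport_subset (u x : W) :
    cs.transport (cs.transport I u) x ⊆ cs.transport I (u * x) := by
  rintro j ⟨l, ⟨i, hi, h⟩, h'⟩
  exact ⟨i, hi, by rw [← mul_assoc, h, mul_assoc, h', mul_assoc]⟩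

/-- A diagram automorphism `θ` which permutes only simple reflections in `I` fixes every
transporter for `I`, and it permutes only simple reflections in the transported set. -/
theorem IsTransporter.apply_eq [Finite B] {x : W} (hx : cs.IsTransporter I x)
    (p : Equiv.Perm B) (θ : W →* W) (hθ : ∀ i, θ (s i) = s (p i)) (hℓ : ∀ w, ℓ (θ w) = ℓ w)
    (hp : ∀ i ∉ I, p i = i) : θ x = x ∧ ∀ i ∉ cs.transport I x, p i = i := by
  induction hn : ℓ x using Nat.strong_induction_on generalizing I x with
  | _ n ih =>
    by_cases hx1 : x = 1
    · subst hx1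
      rw [cs.transport_one]
      exact ⟨map_one _, hp⟩
    obtain ⟨k, hk⟩ := cs.exists_leftDescent_of_ne_one hx1
    rw [IsLeftDescent] at hk
    have hkI : k ∉ I := fun h ↦ by
      have := hx.1 k h
      omega
    obtain ⟨u, hu, x', hx', rfl, hu1, hut, hxt, hlt⟩ := hx.exists_eq_mul cs hk
    have hpJ (i : B) (hi : i ∉ insert k I) : p i = i :=
      hp i fun h ↦ hi (Set.mem_insert_of_mem _ h)
    have hmem {T : Set B} (hT : ∀ i ∉ T, p i = i) (i : B) : p i ∈ T ↔ i ∈ T := by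
      by_cases hi : i ∈ T
      · refine iff_of_true ?_ hi
        by_contra h
        exact h (by rwa [p.injective (hT _ h)])
      · rw [hT i hi]
    have hθinj : θ u ≠ 1 := by
      rw [Ne, ← cs.length_eq_zero_iff, hℓ, cs.length_eq_zero_iff]
      exact hu1
    have hθu : θ u = u := by
      refine IsTransporter.eq_of_mem_parabolic cs (k := k) ⟨?_, ?_⟩ hut hθinj hu1 ?_ hu
      · intro i hi
        obtain ⟨i, rfl⟩ := p.surjective i
        rw [← hθ, ← map_mul, hℓ, hℓ]
        exact hut.1 i ((hmem hp i).1 hi)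
      · intro i hi
        obtain ⟨i, rfl⟩ := p.surjective i
        obtain ⟨j, hj⟩ := hut.2 i ((hmem hp i).1 hi)
        exact ⟨p j, by rw [← hθ, ← map_mul, hj, map_mul, hθ]⟩
      · refine cs.parabolic_induction_left (p := fun u ↦ θ u ∈ cs.parabolic (insert k I))
          (by simp [one_mem]) ?_ hu
        intro i hi w _ _ hw
        rw [map_mul, hθ]
        exact mul_mem (cs.simple_mem_parabolic ((hmem hpJ i).2 hi)) hw
    have hpT (i : B) (hi : i ∈ cs.transport I u) : p i ∈ cs.transport I u := by
      obtain ⟨l, hl, h⟩ := hi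
      refine ⟨p l, (hmem hp l).2 hl, ?_⟩
      have h1 := congrArg θ h
      rwa [map_mul, map_mul, hθ, hθ, hθu] at h1
    have hTJ := cs.transport_subset hu (Set.subset_insert k I)
    -- The complement of the transported set in `insert k I` has only one element.
    have hcard : (insert k I \ cs.transport I u).ncard = 1 := by
      rw [Set.ncard_sdiff hTJ, hut.ncard_transport, Set.ncard_insert_of_notMem hkI]
      omega
    obtain ⟨a, ha⟩ := Set.ncard_eq_one.1 hcard
    have hpI (i : B) (hi : i ∉ cs.transport I u) : p i = i := by
      by_cases hiJ : i ∈ insert k I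
      · have h1 : i ∈ insert k I \ cs.transport I u := ⟨hiJ, hi⟩
        have h2 : p i ∈ insert k I \ cs.transport I u := by
          refine ⟨(hmem hpJ i).2 hiJ, fun h ↦ ?_⟩
          have himg : p '' cs.transport I u = cs.transport I u :=
            Set.eq_of_subset_of_ncard_le (Set.image_subset_iff.2 hpT)
              (p.injective.injOn.ncard_image).ge
          rw [← himg] at h
          obtain ⟨b, hb, hbi⟩ := h
          exact hi (p.injective hbi ▸ hb)
        rw [ha] at h1 h2
        exact h2.trans h1.symm
      · exact hpJ i hiJ
    obtain ⟨h1, h2⟩ := ih _ (hn ▸ hlt) hxt hpI rfl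
    refine ⟨by rw [map_mul, hθu, h1], fun i hi ↦ h2 i fun h ↦ hi ?_⟩
    exact cs.transport_transport_subset u x' h

/-- If the face of cotype `K` of the chamber `x` lies on the walls of all `s i`, `i ∈ I`, then its
chamber closest to `1` is a transporter. -/
theorem exists_isTransporter {x : W} (hx : ∀ i ∈ I, x⁻¹ * s i * x ∈ cs.parabolic K) :
    ∃ y, y⁻¹ * x ∈ cs.parabolic K ∧ ℓ y ≤ ℓ x ∧ cs.IsTransporter I y ∧ cs.transport I y ⊆ K := by
  obtain ⟨b, hb, z, hz, he⟩ := cs.exists_mul_isLeftReduced K x⁻¹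
  obtain ⟨y, rfl⟩ : ∃ y, z = y⁻¹ := ⟨z⁻¹, by simp⟩
  obtain rfl : x = y * b⁻¹ := by rw [← inv_inv x, he, mul_inv_rev, inv_inv]
  have hlen {v : W} (hv : v ∈ cs.parabolic K) : ℓ (y * v) = ℓ y + ℓ v := by
    rw [← cs.length_inv, mul_inv_rev, cs.length_mul_of_isLeftReduced (inv_mem hv) hz,
      cs.length_inv, cs.length_inv, add_comm]
  have hy (i : B) (hi : i ∈ I) : y⁻¹ * s i * y ∈ cs.parabolic K := by
    have h1 : y⁻¹ * s i * y = b⁻¹ * ((y * b⁻¹)⁻¹ * s i * (y * b⁻¹)) * b := by group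
    rw [h1]
    exact mul_mem (mul_mem (inv_mem hb) (hx i hi)) hb
  have hmul (i : B) : s i * y = y * (y⁻¹ * s i * y) := by group
  have hred : cs.IsLeftReduced I y := by
    intro i hi
    have h1 := hlen (hy i hi)
    rw [← hmul] at h1
    have := cs.length_simple_mul_ne y i
    omega
  refine ⟨y, by simpa using inv_mem hb, by rw [hlen (inv_mem hb)]; omega, ⟨hred, fun i hi ↦ ?_⟩, ?_⟩
  · have h1 := hlen (hy i hi)
    rw [← hmul] at h1
    have h2 := hred i hi
    have h3 := cs.length_simple_mul y i
    obtain ⟨j, hj⟩ := cs.length_eq_one_iff.1 (show ℓ (y⁻¹ * s i * y) = 1 by omega)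
    exact ⟨j, by rw [hmul, hj]⟩
  · rintro j ⟨i, hi, h⟩
    rw [← cs.simple_mem_parabolic_iff]
    have h1 : s j = y⁻¹ * s i * y := by rw [mul_assoc, h]; group
    rw [h1]
    exact hy i hi

/-- A residue stabilized by `s i` has chambers on both sides of the wall of `s i`. -/
theorem exists_length_lt_of_conj_mem {g : W} {i : B} (h : g⁻¹ * s i * g ∈ cs.parabolic K) :
    (∃ v ∈ cs.parabolic K, ℓ (g * v) < ℓ (s i * (g * v))) ∧
      ∃ v ∈ cs.parabolic K, ℓ (s i * (g * v)) < ℓ (g * v) := by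
  have h1 : g * (g⁻¹ * s i * g) = s i * g := by group
  by_cases h2 : ℓ (s i * g) < ℓ g
  · exact ⟨⟨_, h, by rwa [h1, cs.simple_mul_simple_cancel_left]⟩, 1, one_mem _, by simpa using h2⟩
  · have h3 := cs.lt_length_simple_mul h2
    exact ⟨⟨1, one_mem _, by simpa using h3⟩, _, h,
      by rwa [h1, cs.simple_mul_simple_cancel_left]⟩

/-- A residue which is not stabilized by `s i` lies on one side of the wall of `s i`. -/
theorem length_lt_of_conj_notMem {x v : W} {i : B} (h : x⁻¹ * s i * x ∉ cs.parabolic K)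
    (hv : v ∈ cs.parabolic K) : ℓ (s i * (x * v)) < ℓ (x * v) ↔ ℓ (s i * x) < ℓ x := by
  by_cases h1 : ℓ (s i * x) < ℓ x
  · refine iff_of_true ?_ h1
    by_contra h2
    refine h ?_
    have h3 := cs.conj_mem_parabolic_of_length_lt (x := s i * x) (i := i) hv
      (by rwa [cs.simple_mul_simple_cancel_left])
      (by rwa [mul_assoc, cs.simple_mul_simple_cancel_left])
    simpa [mul_assoc] using h3
  · refine iff_of_false ?_ h1
    intro h2
    exact h (cs.conj_mem_parabolic_of_length_lt hv (cs.lt_length_simple_mul h1) (by omega))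

end CoxeterSystem

/-! ### Charts of Coxeter complexes -/

namespace PreAbstractSimplicialComplex

variable {V V' : Type*}

/-- A chart of the simplicial complex `A`: a parametrization by the Coxeter complex of `M`, where
`vertex i w` is the vertex of type `i` of the chamber corresponding to `w`. This is the same as an
isomorphism from `M.coxeterComplex` to `A`, see `Chart.map` and
`Chart.exists_iso`. -/
structure Chart {B : Type*} (M : CoxeterMatrix B) (A : PreAbstractSimplicialComplex V) where
  /-- the vertex of type `i` of the chamber corresponding to `w` -/
  vertex : B → M.Group → V
  vertex_eq_vertex : ∀ i j w w', vertex i w = vertex j w' ↔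
    i = j ∧ w⁻¹ * w' ∈ M.toCoxeterSystem.parabolic {i}ᶜ
  mem_iff : ∀ t : Finset V, t ∈ A ↔ t.Nonempty ∧ ∃ w, ∀ v ∈ t, ∃ i, v = vertex i w

theorem singleton_mem_of_mem {A : PreAbstractSimplicialComplex V} {t : Finset V} (ht : t ∈ A)
    {v : V} (hv : v ∈ t) : {v} ∈ A :=
  (A.isRelLowerSet_faces ht).2 (by simpa using hv) (by simp)

theorem mem_of_subset {A : PreAbstractSimplicialComplex V} {t u : Finset V} (ht : t ∈ A)
    (h : u ⊆ t) (hu : u.Nonempty) : u ∈ A :=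
  (A.isRelLowerSet_faces ht).2 h hu

theorem nonempty_of_mem {A : PreAbstractSimplicialComplex V} {t : Finset V} (ht : t ∈ A) :
    t.Nonempty :=
  (A.isRelLowerSet_faces ht).1

namespace Chart

variable {B : Type*} {M : CoxeterMatrix B} {A : PreAbstractSimplicialComplex V}
  {A' : PreAbstractSimplicialComplex V'}

theorem type_eq (c : Chart M A) {i j : B} {w w' : M.Group} (h : c.vertex i w = c.vertex j w') :
    i = j :=
  ((c.vertex_eq_vertex i j w w').1 h).1

theorem vertex_eq_iff (c : Chart M A) {i : B} {w w' : M.Group} :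
    c.vertex i w = c.vertex i w' ↔ w⁻¹ * w' ∈ M.toCoxeterSystem.parabolic {i}ᶜ := by
  rw [c.vertex_eq_vertex]
  simp

theorem vertex_mem_vertices (c : Chart M A) (i : B) (w : M.Group) : c.vertex i w ∈ A.vertices := by
  change {c.vertex i w} ∈ A
  rw [c.mem_iff]
  exact ⟨by simp, w, fun v hv ↦ ⟨i, by simpa using hv⟩⟩

theorem exists_eq_vertex (c : Chart M A) {v : V} (hv : v ∈ A.vertices) :
    ∃ i w, v = c.vertex i w := by
  obtain ⟨-, w, h⟩ := (c.mem_iff {v}).1 hv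
  obtain ⟨i, hi⟩ := h v (by simp)
  exact ⟨i, w, hi⟩

variable (M) in
/-- The tautological chart of a Coxeter complex. -/
def coxeterComplex : Chart M M.coxeterComplex where
  vertex i w := ⟨i, w⟩
  vertex_eq_vertex i j w w' := by
    constructor
    · intro h
      obtain rfl : i = j := congrArg Sigma.fst h
      refine ⟨rfl, ?_⟩
      rw [Sigma.mk.injEq] at h
      exact QuotientGroup.eq.1 (eq_of_heq h.2)
    · rintro ⟨rfl, h⟩
      congr 1
      exact QuotientGroup.eq.2 h
  mem_iff t := by
    refine and_congr Iff.rfl (exists_congr fun w ↦ forall₂_congr fun v _ ↦ ?_)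
    constructor
    · intro h
      exact ⟨v.1, Sigma.ext rfl (heq_of_eq h)⟩
    · rintro ⟨i, rfl⟩
      rfl

/-- The image of a chart under an isomorphism. -/
def map (c : Chart M A) (φ : Iso A A') : Chart M A' where
  vertex i w := φ.toEquiv ⟨c.vertex i w, c.vertex_mem_vertices i w⟩
  vertex_eq_vertex i j w w' := by
    rw [← c.vertex_eq_vertex, Subtype.coe_inj, φ.toEquiv.apply_eq_iff_eq, Subtype.mk.injEq]
  mem_iff t := by
    classical
    have key (u : Finset A.vertices) :
        (u.map φ.toEquiv.toEmbedding).map (Function.Embedding.subtype _) ∈ A' ↔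
          u.Nonempty ∧ ∃ w, ∀ v ∈ u, ∃ i, (v : V) = c.vertex i w := by
      rw [φ.map_mem_iff, c.mem_iff]
      simp
    have lift (ht : ∀ v ∈ t, v ∈ A'.vertices) : ∃ u : Finset A.vertices,
        (u.map φ.toEquiv.toEmbedding).map (Function.Embedding.subtype _) = t := by
      refine ⟨(t.subtype (· ∈ A'.vertices)).map φ.toEquiv.symm.toEmbedding, ?_⟩
      rw [Finset.map_map (f := φ.toEquiv.symm.toEmbedding), ← Equiv.trans_toEmbedding,
        Equiv.symm_trans_self, Equiv.refl_toEmbedding, Finset.map_refl]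
      exact Finset.subtype_map_of_mem ht
    constructor
    · intro ht
      obtain ⟨u, rfl⟩ := lift fun v hv ↦ singleton_mem_of_mem ht hv
      obtain ⟨h1, w, hw⟩ := (key u).1 ht
      refine ⟨by simpa using h1, w, ?_⟩
      simp only [Finset.mem_map, forall_exists_index, and_imp]
      rintro _ _ v hv rfl rfl
      obtain ⟨i, hi⟩ := hw v hv
      refine ⟨i, ?_⟩
      simp [← hi]
    · rintro ⟨hne, w, hw⟩
      obtain ⟨u, rfl⟩ := lift fun v hv ↦ by
        obtain ⟨i, rfl⟩ := hw v hv
        exact Subtype.coe_prop _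
      rw [key]
      refine ⟨by simpa using hne, w, fun v hv ↦ ?_⟩
      obtain ⟨i, hi⟩ := hw (φ.toEquiv v) (by simpa using hv)
      refine ⟨i, ?_⟩
      rw [Subtype.coe_inj, φ.toEquiv.apply_eq_iff_eq] at hi
      rw [hi]

@[simp]
theorem map_vertex (c : Chart M A) (φ : Iso A A') (i : B) (w : M.Group) :
    (c.map φ).vertex i w = φ.toEquiv ⟨c.vertex i w, c.vertex_mem_vertices i w⟩ := rfl

/-- Two charts with the same Coxeter matrix give an isomorphism. -/
theorem exists_iso (c : Chart M A) (c' : Chart M A') :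
    ∃ φ : Iso A A', ∀ i w, (φ.toEquiv ⟨c.vertex i w, c.vertex_mem_vertices i w⟩ : V') =
      c'.vertex i w := by
  have h (v : A.vertices) : ∃ v' : A'.vertices, ∃ i w, (v : V) = c.vertex i w ∧
      (v' : V') = c'.vertex i w := by
    obtain ⟨i, w, hv⟩ := c.exists_eq_vertex v.2
    exact ⟨⟨c'.vertex i w, c'.vertex_mem_vertices i w⟩, i, w, hv, rfl⟩
  choose f hf using h
  have hf' (v : A.vertices) (i : B) (w : M.Group) (hv : (v : V) = c.vertex i w) :
      (f v : V') = c'.vertex i w := by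
    obtain ⟨j, w', h1, h2⟩ := hf v
    rw [h2, c'.vertex_eq_vertex, ← c.vertex_eq_vertex, ← h1, hv]
  have hbij : Function.Bijective f := by
    constructor
    · intro v v' h
      obtain ⟨i, w, h1, h2⟩ := hf v
      obtain ⟨j, w', h3, h4⟩ := hf v'
      rw [← Subtype.coe_inj, h2, h4, c'.vertex_eq_vertex, ← c.vertex_eq_vertex, ← h1, ← h3] at h
      exact Subtype.ext h
    · intro v'
      obtain ⟨i, w, h⟩ := c'.exists_eq_vertex v'.2
      exact ⟨⟨c.vertex i w, c.vertex_mem_vertices i w⟩, Subtype.ext (by rw [hf' _ i w rfl, h])⟩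
  refine ⟨⟨Equiv.ofBijective f hbij, fun t ↦ ?_⟩, fun i w ↦ hf' _ i w rfl⟩
  rw [c.mem_iff, c'.mem_iff]
  simp only [Finset.map_nonempty, Finset.mem_map, Equiv.coe_toEmbedding, Equiv.ofBijective_apply,
    Function.Embedding.subtype_apply, forall_exists_index, and_imp, forall_apply_eq_imp_iff₂]
  refine and_congr Iff.rfl (exists_congr fun w ↦ forall₂_congr fun v _ ↦ exists_congr fun i ↦ ?_)
  obtain ⟨j, w', h1, h2⟩ := hf v
  rw [h1, h2, c.vertex_eq_vertex, c'.vertex_eq_vertex]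

/-- The chart obtained by translating the parameter from the left. -/
def translate (c : Chart M A) (g : M.Group) : Chart M A where
  vertex i w := c.vertex i (g * w)
  vertex_eq_vertex i j w w' := by
    rw [c.vertex_eq_vertex, mul_inv_rev, mul_assoc, inv_mul_cancel_left]
  mem_iff t := by
    rw [c.mem_iff]
    refine and_congr Iff.rfl ⟨fun ⟨w, hw⟩ ↦ ⟨g⁻¹ * w, by simpa using hw⟩, fun ⟨w, hw⟩ ↦ ⟨_, hw⟩⟩

@[simp]
theorem translate_vertex (c : Chart M A) (g : M.Group) (i : B) (w : M.Group) :
    (c.translate g).vertex i w = c.vertex i (g * w) := rfl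

/-! ### Faces and chambers in a chart -/

variable [Fintype B]

open scoped Classical in
/-- The face of cotype `I` of the chamber corresponding to `w`. Its stabilizer in the Coxeter group
is the conjugate of `parabolic I` by `w`. -/
noncomputable def face (c : Chart M A) (I : Set B) (w : M.Group) : Finset V :=
  (Finset.univ.filter (· ∉ I)).image (c.vertex · w)

/-- The chamber corresponding to `w`. -/
noncomputable def chamber (c : Chart M A) (w : M.Group) : Finset V := c.face ∅ w

variable (c : Chart M A) {I J : Set B} {w w' : M.Group}

theorem mem_face {v : V} : v ∈ c.face I w ↔ ∃ i ∉ I, v = c.vertex i w := by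
  simp [face, eq_comm]

theorem mem_chamber {v : V} : v ∈ c.chamber w ↔ ∃ i, v = c.vertex i w := by
  simp [chamber, mem_face]

theorem vertex_mem_chamber (i : B) (w : M.Group) : c.vertex i w ∈ c.chamber w :=
  c.mem_chamber.2 ⟨i, rfl⟩

theorem vertex_mem_face {i : B} (hi : i ∉ I) : c.vertex i w ∈ c.face I w :=
  c.mem_face.2 ⟨i, hi, rfl⟩

theorem face_subset_chamber (I : Set B) (w : M.Group) : c.face I w ⊆ c.chamber w := by
  intro v hv
  obtain ⟨i, -, rfl⟩ := c.mem_face.1 hv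
  exact c.vertex_mem_chamber i w

theorem face_anti (h : I ⊆ J) (w : M.Group) : c.face J w ⊆ c.face I w := by
  intro v hv
  obtain ⟨i, hi, rfl⟩ := c.mem_face.1 hv
  exact c.vertex_mem_face fun h' ↦ hi (h h')

theorem translate_face (g : M.Group) : (c.translate g).face I w = c.face I (g * w) := rfl

theorem face_subset_chamber_iff :
    c.face I w ⊆ c.chamber w' ↔ w⁻¹ * w' ∈ M.toCoxeterSystem.parabolic I := by
  constructor
  · intro h
    refine M.toCoxeterSystem.mem_parabolic_of_forall fun k hk ↦ ?_
    obtain ⟨j, hj⟩ := c.mem_chamber.1 (h (c.vertex_mem_face hk))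
    exact ((c.vertex_eq_vertex _ _ _ _).1 hj).2
  · intro h v hv
    obtain ⟨i, hi, rfl⟩ := c.mem_face.1 hv
    rw [mem_chamber]
    refine ⟨i, c.vertex_eq_iff.2 (M.toCoxeterSystem.parabolic_mono ?_ h)⟩
    rintro j hj rfl
    exact hi hj

theorem face_eq_of_mem (h : w⁻¹ * w' ∈ M.toCoxeterSystem.parabolic I) :
    c.face I w = c.face I w' := by
  have key (i : B) (hi : i ∉ I) : c.vertex i w = c.vertex i w' := by
    refine c.vertex_eq_iff.2 (M.toCoxeterSystem.parabolic_mono ?_ h)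
    rintro j hj rfl
    exact hi hj
  ext v
  simp only [mem_face]
  exact exists_congr fun i ↦ and_congr_right fun hi ↦ by rw [key i hi]

theorem chamber_subset_chamber_iff : c.chamber w ⊆ c.chamber w' ↔ w = w' := by
  rw [chamber, face_subset_chamber_iff, CoxeterSystem.mem_parabolic_empty, inv_mul_eq_one]

theorem chamber_injective : Function.Injective c.chamber := fun _ _ h ↦
  c.chamber_subset_chamber_iff.1 h.subset

theorem card_face (I : Set B) (w : M.Group) : (c.face I w).card + I.ncard = Fintype.card B := by
  classical
  rw [face, Finset.card_image_of_injective _ fun i j h ↦ c.type_eq h, Set.ncard_eq_toFinset_card',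
    ← Finset.card_univ, add_comm]
  convert Finset.card_filter_add_card_filter_not (s := Finset.univ) (p := (· ∈ I)) using 2
  congr 1
  ext
  simp

theorem card_chamber (w : M.Group) : (c.chamber w).card = Fintype.card B := by
  have := c.card_face ∅ w
  rwa [Set.ncard_empty, add_zero] at this

theorem mem_iff_subset_chamber {t : Finset V} : t ∈ A ↔ t.Nonempty ∧ ∃ w, t ⊆ c.chamber w := by
  rw [c.mem_iff]
  simp only [Finset.subset_iff, mem_chamber]

theorem face_mem (h : (c.face I w).Nonempty) : c.face I w ∈ A :=
  c.mem_iff_subset_chamber.2 ⟨h, w, c.face_subset_chamber I w⟩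

theorem face_isSimplex (I : Set B) (w : M.Group) : A.IsSimplex (c.face I w) :=
  (c.face I w).eq_empty_or_nonempty.imp id c.face_mem

theorem chamber_isSimplex (w : M.Group) : A.IsSimplex (c.chamber w) := c.face_isSimplex ∅ w

theorem exists_eq_face {t : Finset V} (ht : t ⊆ c.chamber w) : ∃ I, t = c.face I w := by
  refine ⟨{i | c.vertex i w ∉ t}, ?_⟩
  ext v
  rw [mem_face]
  constructor
  · intro hv
    obtain ⟨i, rfl⟩ := c.mem_chamber.1 (ht hv)
    exact ⟨i, by simpa using hv, rfl⟩
  · rintro ⟨i, hi, rfl⟩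
    simpa using hi

theorem exists_eq_face_of_mem {t : Finset V} (ht : t ∈ A) : ∃ I w, t = c.face I w := by
  obtain ⟨-, w, hw⟩ := c.mem_iff_subset_chamber.1 ht
  obtain ⟨I, hI⟩ := c.exists_eq_face hw
  exact ⟨I, w, hI⟩

theorem exists_subset_chamber {t : Finset V} (ht : A.IsSimplex t) : ∃ w, t ⊆ c.chamber w := by
  rcases ht with rfl | ht
  · exact ⟨1, by simp⟩
  · exact (c.mem_iff_subset_chamber.1 ht).2

theorem chamber_mem [Nonempty B] (w : M.Group) : c.chamber w ∈ A :=
  c.face_mem ⟨c.vertex (Classical.arbitrary B) w, c.vertex_mem_chamber _ w⟩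

theorem isChamber_iff [Nonempty B] {t : Finset V} : A.IsChamber t ↔ ∃ w, t = c.chamber w := by
  constructor
  · intro ht
    obtain ⟨-, w, hw⟩ := c.mem_iff_subset_chamber.1 ht.prop
    exact ⟨w, (ht.eq_of_ge (c.chamber_mem w) hw).symm⟩
  · rintro ⟨w, rfl⟩
    refine ⟨c.chamber_mem w, fun t ht h ↦ ?_⟩
    obtain ⟨-, w', hw'⟩ := c.mem_iff_subset_chamber.1 ht
    rw [c.chamber_subset_chamber_iff.1 (h.trans hw')]
    exact hw'

theorem card_le_of_mem (c : Chart M A) {t : Finset V} (ht : t ∈ A) : t.card ≤ Fintype.card B := by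
  obtain ⟨I, w, rfl⟩ := c.exists_eq_face_of_mem ht
  have := c.card_face I w
  omega

end Chart

theorem IsCoxeterComplex.exists_chart {A : PreAbstractSimplicialComplex V}
    (hA : A.IsCoxeterComplex) : ∃ (n : ℕ) (M : CoxeterMatrix (Fin n)), Nonempty (Chart M A) := by
  obtain ⟨n, M, ⟨φ⟩⟩ := hA
  exact ⟨n, M, ⟨(Chart.coxeterComplex M).map φ⟩⟩

end PreAbstractSimplicialComplex

/-! ### Rigidity of charts -/

namespace PreAbstractSimplicialComplex.Chart

variable {V B : Type*} {M : CoxeterMatrix B} {A : PreAbstractSimplicialComplex V}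

theorem vertex_mul_simple (c : Chart M A) {i j : B} (h : i ≠ j) (w : M.Group) :
    c.vertex i (w * M.toCoxeterSystem.simple j) = c.vertex i w := by
  rw [c.vertex_eq_iff]
  simpa using M.toCoxeterSystem.simple_mem_parabolic (I := {i}ᶜ) (i := j) (by simpa using h.symm)

theorem mul_simple_ne (w : M.Group) (j : B) : w * M.toCoxeterSystem.simple j ≠ w := by
  intro h
  have := M.toCoxeterSystem.length_mul_simple_ne w j
  rw [h] at this
  exact this rfl

variable [Fintype B]

/-- If two charts of a complex agree on a chamber up to a permutation `p` of the types, then so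
they do on the adjacent chambers: of the two chambers containing a given panel, the one which is
not the given chamber is mapped to the one which is not the given chamber. -/
theorem vertex_mul_simple_eq (c c' : Chart M A) (p : Equiv.Perm B) {w w' : M.Group}
    (h : ∀ i, c.vertex i w = c'.vertex (p i) w') (j i : B) :
    c.vertex i (w * M.toCoxeterSystem.simple j) =
      c'.vertex (p i) (w' * M.toCoxeterSystem.simple (p j)) := by
  have : Nonempty B := ⟨j⟩
  obtain ⟨z, hz⟩ := c'.exists_subset_chamber (c.chamber_isSimplex (w * M.toCoxeterSystem.simple j))
  have hsub (i : B) (hi : i ≠ j) : w'⁻¹ * z ∈ M.toCoxeterSystem.parabolic {p i}ᶜ := by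
    obtain ⟨k, hk⟩ := c'.mem_chamber.1 (hz (c.vertex_mem_chamber i _))
    rw [c.vertex_mul_simple hi, h] at hk
    exact ((c'.vertex_eq_vertex _ _ _ _).1 hk).2
  have hz1 : w'⁻¹ * z ∈ M.toCoxeterSystem.parabolic {p j} := by
    refine M.toCoxeterSystem.mem_parabolic_of_forall fun k hk ↦ ?_
    obtain ⟨i, rfl⟩ := p.surjective k
    exact hsub i fun hi ↦ hk (by simp [hi])
  have hz2 : z = w' * M.toCoxeterSystem.simple (p j) := by
    rcases M.toCoxeterSystem.mem_parabolic_singleton hz1 with h1 | h1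
    · exfalso
      obtain rfl : w' = z := inv_mul_eq_one.1 h1
      have h2 : c.chamber (w * M.toCoxeterSystem.simple j) ⊆ c.chamber w := by
        intro v hv
        obtain ⟨k, rfl⟩ := c'.mem_chamber.1 (hz hv)
        rw [← p.apply_symm_apply k, ← h]
        exact c.vertex_mem_chamber _ _
      exact mul_simple_ne w j (c.chamber_subset_chamber_iff.1 h2)
    · rw [← h1, mul_inv_cancel_left]
  subst hz2
  by_cases hi : i = j
  · subst hi
    obtain ⟨k, hk⟩ := c'.mem_chamber.1 (hz (c.vertex_mem_chamber i _))
    obtain ⟨k, rfl⟩ := p.surjective k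
    by_cases hki : k = i
    · rw [hk, hki]
    · rw [c'.vertex_mul_simple fun h ↦ hki (p.injective h), ← h, ← c.vertex_mul_simple hki] at hk
      exact absurd (c.type_eq hk).symm hki
  · rw [c.vertex_mul_simple hi, c'.vertex_mul_simple fun h ↦ hi (p.injective h), h]

/-- Two charts of a complex which agree on a chamber are equal. -/
theorem vertex_eq_of_chamber (c c' : Chart M A) {w₀ : M.Group}
    (h : ∀ i, c.vertex i w₀ = c'.vertex i w₀) (i : B) (w : M.Group) :
    c.vertex i w = c'.vertex i w := by
  obtain ⟨g, rfl⟩ : ∃ g, w = w₀ * g := ⟨w₀⁻¹ * w, by simp⟩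
  induction g using M.toCoxeterSystem.simple_induction_right generalizing i with
  | one => simpa using h i
  | mul_simple_right g j ih =>
    rw [← mul_assoc]
    exact c.vertex_mul_simple_eq c' (Equiv.refl B) ih j i

/-- If two charts of a complex map `1` to the same chamber, inducing the permutation `p` of the
types, then they differ by an automorphism of the Coxeter group which permutes the simple
reflections by `p`. -/
theorem exists_automorphism (c c' : Chart M A) (p : Equiv.Perm B)
    (h : ∀ i, c.vertex i 1 = c'.vertex (p i) 1) :
    ∃ θ : M.Group →* M.Group,
      (∀ i, θ (M.toCoxeterSystem.simple i) = M.toCoxeterSystem.simple (p i)) ∧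
      (∀ w, M.toCoxeterSystem.length (θ w) = M.toCoxeterSystem.length w) ∧
      ∀ i w, c.vertex i w = c'.vertex (p i) (θ w) := by
  set cs := M.toCoxeterSystem with hcs
  have hword (ω : List B) (i : B) :
      c.vertex i (cs.wordProd ω) = c'.vertex (p i) (cs.wordProd (ω.map p)) := by
    induction ω using List.reverseRecOn generalizing i with
    | nil => simpa using h i
    | append_singleton ω j ih =>
      rw [List.map_append, cs.wordProd_append, cs.wordProd_append, List.map_singleton,
        cs.wordProd_singleton, cs.wordProd_singleton]
      exact c.vertex_mul_simple_eq c' p ih j i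
  have hiff (ω ω' : List B) : cs.wordProd ω = cs.wordProd ω' ↔
      cs.wordProd (ω.map p) = cs.wordProd (ω'.map p) := by
    rw [← c.chamber_injective.eq_iff, ← c'.chamber_injective.eq_iff]
    have hch (ω : List B) :
        c.chamber (cs.wordProd ω) = c'.chamber (cs.wordProd (ω.map p)) := by
      ext v
      rw [c.mem_chamber, c'.mem_chamber]
      simp only [hword]
      exact ⟨fun ⟨i, hi⟩ ↦ ⟨p i, hi⟩, fun ⟨i, hi⟩ ↦ ⟨p.symm i, by simpa using hi⟩⟩
    rw [hch, hch]
  choose ω hω hωr using fun w ↦ cs.exists_isReduced w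
  have hθ (ω' : List B) :
      cs.wordProd ((ω (cs.wordProd ω')).map p) = cs.wordProd (ω'.map p) :=
    (hiff _ _).1 (hωr _).symm
  let θ : M.Group →* M.Group := MonoidHom.mk' (fun w ↦ cs.wordProd ((ω w).map p)) (by
    intro a b
    have h1 : a * b = cs.wordProd (ω a ++ ω b) := by
      rw [cs.wordProd_append, ← hωr, ← hωr]
    change cs.wordProd ((ω (a * b)).map p) = _
    rw [h1, hθ, List.map_append, cs.wordProd_append])
  have hθw (ω' : List B) : θ (cs.wordProd ω') = cs.wordProd (ω'.map p) := hθ ω'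
  refine ⟨θ, fun i ↦ ?_, fun w ↦ le_antisymm ?_ ?_, fun i w ↦ ?_⟩
  · rw [← cs.wordProd_singleton, hθw]
    simp
  · conv_rhs => rw [hωr w, (hω w).eq]
    conv_lhs => rw [hωr w, hθw]
    exact (cs.length_wordProd_le _).trans (by simp)
  · obtain ⟨ω', h1, h2⟩ := cs.exists_isReduced (θ w)
    have h3 : w = cs.wordProd (ω'.map p.symm) := by
      rw [hωr w, hiff, ← hθw, ← hωr, h2]
      simp
    rw [h2, h1.eq]
    conv_lhs => rw [h3]
    exact (cs.length_wordProd_le _).trans (by simp)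
  · conv_lhs => rw [hωr w, hword, ← hθw, ← hωr]

end PreAbstractSimplicialComplex.Chart

/-! ### Projections in a building -/

namespace Building

open PreAbstractSimplicialComplex

variable {V : Type*} (Δ : Building V)

theorem isSimplex_of_apartment {A : PreAbstractSimplicialComplex V} (hA : A ∈ Δ.apartments)
    {t : Finset V} (ht : A.IsSimplex t) : Δ.toPreAbstractSimplicialComplex.IsSimplex t :=
  ht.imp id fun h ↦ Δ.apartment_le A hA h

variable {B : Type*} {M : CoxeterMatrix B} {A A' : PreAbstractSimplicialComplex V}

/-- The second building axiom in terms of charts. -/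
theorem exists_chart (hA : A ∈ Δ.apartments) (hA' : A' ∈ Δ.apartments) (c : Chart M A)
    {t u : Finset V} (ht : A.IsSimplex t) (hu : A.IsSimplex u) (ht' : A'.IsSimplex t)
    (hu' : A'.IsSimplex u) :
    ∃ c' : Chart M A', (∀ i w, c.vertex i w ∈ t → c'.vertex i w = c.vertex i w) ∧
      ∀ i w, c.vertex i w ∈ u → c'.vertex i w = c.vertex i w := by
  obtain ⟨φ, hφ, hφ'⟩ := Δ.exists_iso A hA A' hA' t u ht hu ht' hu'
  exact ⟨c.map φ, fun i w h ↦ hφ ⟨_, c.vertex_mem_vertices i w⟩ h,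
    fun i w h ↦ hφ' ⟨_, c.vertex_mem_vertices i w⟩ h⟩

variable [Fintype B]

/-- The vertex `v` is sent to the vertex of type `i` of the chamber `w` by the retraction centered
at the chamber `y` of the chart `γ`: this is so in some chart which agrees with `γ` at `y`. -/
def RetractsTo (γ : Chart M A) (y : M.Group) (v : V) (i : B) (w : M.Group) : Prop :=
  ∃ F ∈ Δ.apartments, ∃ φ : Chart M F, (∀ k, φ.vertex k y = γ.vertex k y) ∧ φ.vertex i w = v

variable {Δ}

/-- The retraction is well defined. -/
theorem RetractsTo.unique {γ : Chart M A} {y : M.Group} {v : V} {i i' : B} {w w' : M.Group}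
    (h : Δ.RetractsTo γ y v i w) (h' : Δ.RetractsTo γ y v i' w') :
    i = i' ∧ w⁻¹ * w' ∈ M.toCoxeterSystem.parabolic {i}ᶜ := by
  obtain ⟨F, hF, φ, hφ, rfl⟩ := h
  obtain ⟨F', hF', φ', hφ', he⟩ := h'
  have hch : φ.chamber y = φ'.chamber y := by
    ext v
    simp only [Chart.mem_chamber, hφ, hφ']
  obtain ⟨φ₂, h1, h2⟩ := Δ.exists_chart hF hF' φ (φ.chamber_isSimplex y)
    (Or.inr (φ.vertex_mem_vertices i w)) (hch ▸ φ'.chamber_isSimplex y)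
    (Or.inr (he ▸ φ'.vertex_mem_vertices i' w'))
  have h3 (k : B) : φ₂.vertex k y = φ'.vertex k y := by
    rw [h1 k y (φ.vertex_mem_chamber k y), hφ, hφ']
  have h4 := h2 i w (by simp)
  rw [φ₂.vertex_eq_of_chamber φ' h3, ← he] at h4
  exact (φ'.vertex_eq_vertex _ _ _ _).1 h4

/-- The retraction maps adjacent chambers to adjacent or equal chambers. -/
theorem RetractsTo.exists_mul_simple (hA : A ∈ Δ.apartments) (hA' : A' ∈ Δ.apartments)
    {γ : Chart M A} {y : M.Group} {μ : Chart M A'} {x w : M.Group}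
    (h : ∀ i, Δ.RetractsTo γ y (μ.vertex i x) i w) (j : B) :
    ∃ w', (w' = w ∨ w' = w * M.toCoxeterSystem.simple j) ∧
      ∀ i, Δ.RetractsTo γ y (μ.vertex i (x * M.toCoxeterSystem.simple j)) i w' := by
  obtain ⟨F, hF, h1, h2⟩ := Δ.exists_apartment _ _
    (Δ.isSimplex_of_apartment hA (γ.chamber_isSimplex y))
    (Δ.isSimplex_of_apartment hA' (μ.chamber_isSimplex (x * M.toCoxeterSystem.simple j)))
  obtain ⟨φ, hφ, -⟩ := Δ.exists_chart hA hF γ (γ.chamber_isSimplex y) (γ.chamber_isSimplex y) h1 h1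
  have hφy (k : B) : φ.vertex k y = γ.vertex k y := hφ k y (γ.vertex_mem_chamber k y)
  obtain ⟨z, hz⟩ := φ.exists_subset_chamber h2
  have hvz (i : B) (hi : i ≠ j) :
      μ.vertex i (x * M.toCoxeterSystem.simple j) = φ.vertex i z ∧
        w⁻¹ * z ∈ M.toCoxeterSystem.parabolic {i}ᶜ := by
    obtain ⟨i', hi'⟩ := φ.mem_chamber.1 (hz (μ.vertex_mem_chamber i _))
    have h3 : Δ.RetractsTo γ y (μ.vertex i x) i' z :=
      ⟨F, hF, φ, hφy, by rw [← hi', μ.vertex_mul_simple hi]⟩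
    obtain ⟨rfl, h4⟩ := (h i).unique h3
    exact ⟨hi', h4⟩
  refine ⟨z, ?_, fun i ↦ ⟨F, hF, φ, hφy, ?_⟩⟩
  · have hz1 : w⁻¹ * z ∈ M.toCoxeterSystem.parabolic {j} :=
      M.toCoxeterSystem.mem_parabolic_of_forall fun k hk ↦ (hvz k hk).2
    rcases M.toCoxeterSystem.mem_parabolic_singleton hz1 with h3 | h3
    · exact Or.inl (inv_mul_eq_one.1 h3).symm
    · exact Or.inr (by rw [← h3, mul_inv_cancel_left])
  · by_cases hi : i = j
    · subst hi
      obtain ⟨k, hk⟩ := φ.mem_chamber.1 (hz (μ.vertex_mem_chamber i _))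
      by_cases hki : k = i
      · rw [hk, hki]
      · rw [← (hvz k hki).1] at hk
        exact absurd (μ.type_eq hk).symm hki
    · exact (hvz i hi).1.symm

/-- Projections are intrinsic: if two charts agree at the chamber `x` and at the face of cotype `I`
of the chamber `y`, and if `y` is the projection of `x` to this face, then they agree at `y`.
Retracting a minimal gallery of the second apartment onto an apartment that contains both images
of `y` gives a gallery of this length from the second one to a chamber at the same position from the
first one; the gate property of residues in a Coxeter group does not allow this. -/
theorem vertex_eq_of_isLeftReduced (hA : A ∈ Δ.apartments) (hA' : A' ∈ Δ.apartments)
    {ν : Chart M A} {μ : Chart M A'} {x y : M.Group} {I : Set B}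
    (hx : ∀ i, μ.vertex i x = ν.vertex i x) (hI : ∀ i ∉ I, μ.vertex i y = ν.vertex i y)
    (hred : M.toCoxeterSystem.IsLeftReduced I (y⁻¹ * x)) (i : B) :
    μ.vertex i y = ν.vertex i y := by
  set cs := M.toCoxeterSystem with hcs
  obtain ⟨G, hG, h1, h2⟩ := Δ.exists_apartment _ _
    (Δ.isSimplex_of_apartment hA (ν.chamber_isSimplex y))
    (Δ.isSimplex_of_apartment hA' (μ.chamber_isSimplex y))
  obtain ⟨γ, hγ, -⟩ := Δ.exists_chart hA hG ν (ν.chamber_isSimplex y) (ν.chamber_isSimplex y) h1 h1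
  have hγy (k : B) : γ.vertex k y = ν.vertex k y := hγ k y (ν.vertex_mem_chamber k y)
  have hstart (i : B) : Δ.RetractsTo γ y (μ.vertex i x) i x :=
    ⟨A, hA, ν, fun k ↦ (hγy k).symm, (hx i).symm⟩
  have hgallery (g : M.Group) : ∃ w, cs.length (x⁻¹ * w) ≤ cs.length g ∧
      ∀ i, Δ.RetractsTo γ y (μ.vertex i (x * g)) i w := by
    have hg : g ∈ cs.parabolic Set.univ := by rw [cs.parabolic_univ]; trivial
    refine cs.parabolic_induction_right (p := fun g ↦ ∃ w, cs.length (x⁻¹ * w) ≤ cs.length g ∧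
      ∀ i, Δ.RetractsTo γ y (μ.vertex i (x * g)) i w) ⟨x, by simp, by simpa using hstart⟩ ?_ hg
    rintro j - g - hlt ⟨w, hw, hr⟩
    obtain ⟨w', hw', hr'⟩ := RetractsTo.exists_mul_simple hG hA' hr j
    refine ⟨w', ?_, by simpa only [mul_assoc] using hr'⟩
    rcases hw' with rfl | rfl
    · omega
    · rw [← mul_assoc, ← hcs]
      have := cs.length_mul_simple (x⁻¹ * w) j
      omega
  obtain ⟨w, hw, hr⟩ := hgallery (x⁻¹ * y)
  rw [mul_inv_cancel_left] at hr
  obtain ⟨z, hz⟩ := γ.exists_subset_chamber h2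
  have hwz (i : B) : μ.vertex i y = γ.vertex i z ∧ w⁻¹ * z ∈ cs.parabolic {i}ᶜ := by
    obtain ⟨k, hk⟩ := γ.mem_chamber.1 (hz (μ.vertex_mem_chamber i y))
    obtain ⟨rfl, h3⟩ := (hr i).unique ⟨G, hG, γ, fun _ ↦ rfl, hk.symm⟩
    exact ⟨hk, h3⟩
  obtain rfl : w = z := by
    rw [← inv_mul_eq_one, ← cs.mem_parabolic_empty]
    exact cs.mem_parabolic_of_forall fun k _ ↦ (hwz k).2
  have hyw : y⁻¹ * w ∈ cs.parabolic I := by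
    rw [← γ.face_subset_chamber_iff]
    intro v hv
    obtain ⟨k, hk, rfl⟩ := γ.mem_face.1 hv
    rw [hγy, ← hI k hk]
    exact hz (μ.vertex_mem_chamber k y)
  have hlen := cs.length_mul_of_isLeftReduced (inv_mem hyw) hred
  have h3 : (y⁻¹ * w)⁻¹ * (y⁻¹ * x) = (x⁻¹ * w)⁻¹ := by group
  have h4 : y⁻¹ * x = (x⁻¹ * y)⁻¹ := by group
  rw [h3, cs.length_inv, cs.length_inv, h4, cs.length_inv] at hlen
  have h5 : y⁻¹ * w = 1 := cs.length_eq_zero_iff.1 (by omega)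
  rw [(hwz i).1, ← inv_mul_eq_one.1 h5, hγy]

/-- The projection of a common simplex of two apartments to another common simplex is a common
simplex as well. -/
theorem face_isSimplex_of_isLeftReduced (hA : A ∈ Δ.apartments) (hA' : A' ∈ Δ.apartments)
    {ν : Chart M A} {J K : Set B} {g : M.Group} (hJ : A'.IsSimplex (ν.face J 1))
    (hK : A'.IsSimplex (ν.face K g)) (hg : M.toCoxeterSystem.IsLeftReduced J g) :
    A'.IsSimplex (ν.face {j ∈ J | g⁻¹ * M.toCoxeterSystem.simple j * g ∈
      M.toCoxeterSystem.parabolic K} 1) := by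
  set cs := M.toCoxeterSystem with hcs
  set P := {j ∈ J | g⁻¹ * cs.simple j * g ∈ cs.parabolic K} with hP
  obtain ⟨β, -, hβK⟩ := Δ.exists_chart hA hA' ν (ν.face_isSimplex J 1) (ν.face_isSimplex K g) hJ hK
  obtain ⟨E, hE, h1, h2⟩ := Δ.exists_apartment _ _
    (Δ.isSimplex_of_apartment hA (ν.chamber_isSimplex 1))
    (Δ.isSimplex_of_apartment hA' (β.chamber_isSimplex g))
  have hνβ : ν.face K g ⊆ β.chamber g := by
    intro v hv
    obtain ⟨i, hi, rfl⟩ := ν.mem_face.1 hv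
    rw [← hβK i g hv]
    exact β.vertex_mem_chamber i g
  have hsub {F : PreAbstractSimplicialComplex V} {t u : Finset V} (ht : F.IsSimplex t)
      (h : u ⊆ t) : F.IsSimplex u := by
    rcases u.eq_empty_or_nonempty with rfl | hu
    · exact Or.inl rfl
    · rcases ht with rfl | ht
      · exact absurd hu (by simp [Finset.subset_empty.1 h])
      · exact Or.inr (mem_of_subset ht h hu)
  obtain ⟨ε, hε1, hεK⟩ := Δ.exists_chart hA hE ν (ν.chamber_isSimplex 1) (ν.face_isSimplex K g) h1
    (hsub h2 hνβ)
  obtain ⟨g', hg'⟩ := ε.exists_subset_chamber h2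
  have hv : g⁻¹ * g' ∈ cs.parabolic K := by
    rw [← ε.face_subset_chamber_iff]
    intro v hv
    obtain ⟨i, hi, rfl⟩ := ε.mem_face.1 hv
    rw [hεK i g (ν.vertex_mem_face hi)]
    exact hg' (hνβ (ν.vertex_mem_face hi))
  obtain ⟨q, hq, r, hr, he⟩ := cs.exists_mul_eq_mul_isLeftReduced hg hv
  rw [mul_inv_cancel_left] at he
  have hch : β.chamber g = ε.chamber g' :=
    Finset.eq_of_subset_of_card_le hg' (by rw [β.card_chamber, ε.card_chamber])
  have hfJ : ε.face J 1 = ν.face J 1 := by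
    ext v
    simp only [Chart.mem_face, hε1 _ _ (ν.vertex_mem_chamber _ 1)]
  obtain ⟨μ, hμ1, hμJ⟩ := Δ.exists_chart hE hA' ε (ε.chamber_isSimplex g') (ε.face_isSimplex J 1)
    (hch ▸ β.chamber_isSimplex g) (hfJ ▸ hJ)
  have hqJ : q ∈ cs.parabolic J := cs.parabolic_mono (fun j hj ↦ hj.1) hq
  have hq1 {F : PreAbstractSimplicialComplex V} (c : Chart M F) (i : B) (hi : i ∉ J) :
      c.vertex i q = c.vertex i 1 := by
    rw [eq_comm, c.vertex_eq_iff]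
    simpa using cs.parabolic_mono (show J ⊆ {i}ᶜ by rintro j hj rfl; exact hi hj) hqJ
  have key := vertex_eq_of_isLeftReduced hE hA' (ν := ε) (μ := μ) (x := g') (y := q) (I := J)
    (fun i ↦ hμ1 i g' (ε.vertex_mem_chamber i g'))
    (fun i hi ↦ by rw [hq1 μ i hi, hq1 ε i hi, hμJ i 1 (ε.vertex_mem_face hi)])
    (by rw [he, inv_mul_cancel_left]; exact hr)
  have hfP : ν.face P 1 = μ.face P q := by
    rw [← μ.face_eq_of_mem (w := 1) (by simpa using hq)]
    have : ε.face P 1 = ε.face P q := ε.face_eq_of_mem (by simpa using hq)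
    ext v
    rw [← Finset.ext_iff.1 (μ.face_eq_of_mem (w := q) (w' := 1) (by simpa using inv_mem hq)) v]
    have h3 := Finset.ext_iff.1 this v
    simp only [Chart.mem_face, hε1 _ _ (ν.vertex_mem_chamber _ 1), key] at h3 ⊢
    exact h3
  rw [hfP]
  exact μ.face_isSimplex P q

end Building

/-! ### Isomorphisms fixing a common simplex of maximal dimension -/

namespace Building

open PreAbstractSimplicialComplex

variable {V : Type*} {Δ : Building V} {B : Type*} {M : CoxeterMatrix B}
  {A A' : PreAbstractSimplicialComplex V} [Fintype B]

/-- Every common simplex of two apartments lies on all the walls which contain a common simplex of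
maximal dimension: otherwise its projection to the latter would be a larger common simplex. -/
theorem conj_mem_of_card_le (hA : A ∈ Δ.apartments) (hA' : A' ∈ Δ.apartments) {ν : Chart M A}
    {I K : Set B} {g : M.Group} (hd : ν.face I 1 ∈ A ⊓ A')
    (hmax : ∀ e ∈ A ⊓ A', e.card ≤ (ν.face I 1).card) (hK : ν.face K g ∈ A') {i : B} (hi : i ∈ I) :
    g⁻¹ * M.toCoxeterSystem.simple i * g ∈ M.toCoxeterSystem.parabolic K := by
  set cs := M.toCoxeterSystem with hcs
  obtain ⟨p, hp, h, hh, rfl⟩ := cs.exists_mul_isLeftReduced I g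
  set P := {j ∈ I | h⁻¹ * cs.simple j * h ∈ cs.parabolic K} with hP
  have hface : (ν.translate p).face I 1 = ν.face I 1 := by
    rw [ν.translate_face, mul_one]
    exact (ν.face_eq_of_mem (by simpa using hp)).symm
  have hPI : P ⊆ I := fun j hj ↦ hj.1
  have h1 : A'.IsSimplex ((ν.translate p).face P 1) :=
    face_isSimplex_of_isLeftReduced hA hA' (hface ▸ Or.inr hd.2) (Or.inr hK) hh
  have hne : ((ν.translate p).face P 1).Nonempty :=
    (hface ▸ nonempty_of_mem hd.1).mono ((ν.translate p).face_anti hPI 1)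
  have h2 := hmax _ ⟨(ν.translate p).face_mem hne, h1.resolve_left hne.ne_empty⟩
  have h3 := ν.card_face I 1
  have h4 := (ν.translate p).card_face P 1
  have hPeq : P = I := Set.eq_of_subset_of_ncard_le hPI (by omega)
  have h5 (j : B) (hj : j ∈ I) : h⁻¹ * cs.simple j * h ∈ cs.parabolic K := by
    rw [← hPeq] at hj
    exact hj.2
  have h6 : (p * h)⁻¹ * cs.simple i * (p * h) = h⁻¹ * (p⁻¹ * cs.simple i * p) * h := by group
  rw [h6]
  exact cs.conj_mem_of_mem_parabolic h5
    (mul_mem (mul_mem (inv_mem hp) (cs.simple_mem_parabolic hi)) hp)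

end Building

namespace PreAbstractSimplicialComplex.Chart

variable {V B : Type*} [Fintype B] {M : CoxeterMatrix B} {A : PreAbstractSimplicialComplex V}

/-- Two charts which agree on the face of cotype `I` of the chamber `1` agree on all vertices lying
on the walls which contain this face. -/
theorem vertex_eq_of_conj_mem (c c' : Chart M A) {I : Set B}
    (h : ∀ k ∉ I, c.vertex k 1 = c'.vertex k 1) {i : B} {x : M.Group}
    (hx : ∀ j ∈ I, x⁻¹ * M.toCoxeterSystem.simple j * x ∈ M.toCoxeterSystem.parabolic {i}ᶜ) :
    c.vertex i x = c'.vertex i x := by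
  set cs := M.toCoxeterSystem with hcs
  obtain ⟨p, hp⟩ := c'.exists_subset_chamber (c.chamber_isSimplex 1)
  have hpI : p ∈ cs.parabolic I := by
    have : c'.face I 1 ⊆ c'.chamber p := by
      intro v hv
      obtain ⟨k, hk, rfl⟩ := c'.mem_face.1 hv
      rw [← h k hk]
      exact hp (c.vertex_mem_chamber k 1)
    simpa using c'.face_subset_chamber_iff.1 this
  -- The stabilizer of the common face fixes all vertices under consideration; so `c'` can be
  -- replaced by a chart which maps `1` to the same chamber as `c`.
  have hperm (i : B) : ∃ j, c.vertex i 1 = (c'.translate p).vertex j 1 := by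
    obtain ⟨j, hj⟩ := c'.mem_chamber.1 (hp (c.vertex_mem_chamber i 1))
    exact ⟨j, by rw [hj, translate_vertex, mul_one]⟩
  choose f hf using hperm
  have hinj : Function.Injective f := fun i j hij ↦ c.type_eq (by rw [hf, hf, hij])
  obtain ⟨θ, hθ, hℓ, hvertex⟩ := c.exists_automorphism (c'.translate p)
    (Equiv.ofBijective f (Finite.injective_iff_bijective.1 hinj)) hf
  have hfix (k : B) (hk : k ∉ I) : Equiv.ofBijective f (Finite.injective_iff_bijective.1 hinj) k
      = k := by
    have h1 : c'.vertex k 1 = c'.vertex k p := by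
      rw [c'.vertex_eq_iff]
      simpa using cs.parabolic_mono (show I ⊆ {k}ᶜ by rintro j hj rfl; exact hk hj) hpI
    have h2 := hf k
    rw [h k hk, h1, translate_vertex, mul_one] at h2
    exact (c'.type_eq h2).symm
  obtain ⟨y, hyx, -, hy, hyi⟩ := cs.exists_isTransporter hx
  obtain ⟨hθy, hpi⟩ := hy.apply_eq cs _ θ hθ hℓ hfix
  have hi := hpi i fun hi ↦ hyi hi rfl
  have hy' (j : B) (hj : j ∈ I) : y⁻¹ * cs.simple j * y ∈ cs.parabolic {i}ᶜ := by
    have : y⁻¹ * cs.simple j * y = (y⁻¹ * x) * (x⁻¹ * cs.simple j * x) * (y⁻¹ * x)⁻¹ := by group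
    rw [this]
    exact mul_mem (mul_mem hyx (hx j hj)) (inv_mem hyx)
  rw [← c.vertex_eq_iff.2 hyx, ← c'.vertex_eq_iff.2 hyx, hvertex, hθy, hi, translate_vertex,
    eq_comm, c'.vertex_eq_iff, ← mul_assoc]
  exact cs.conj_mem_of_mem_parabolic hy' hpI

end PreAbstractSimplicialComplex.Chart

namespace Building

open PreAbstractSimplicialComplex

variable {V : Type*} {Δ : Building V} {B : Type*} {M : CoxeterMatrix B}
  {A A' : PreAbstractSimplicialComplex V} [Fintype B]

theorem fixes_of_card_le (hA : A ∈ Δ.apartments) (hA' : A' ∈ Δ.apartments) (c : Chart M A)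
    (ψ : Iso A A') {d : Finset V} (hd : d ∈ A ⊓ A') (hmax : ∀ e ∈ A ⊓ A', e.card ≤ d.card)
    (hψ : ψ.Fixes d) {t : Finset V} (ht : t ∈ A ⊓ A') : ψ.Fixes t := by
  obtain ⟨I, y, rfl⟩ := c.exists_eq_face_of_mem hd.1
  obtain ⟨ν, hν⟩ : ∃ ν : Chart M A, c.face I y = ν.face I 1 :=
    ⟨c.translate y, by rw [c.translate_face, mul_one]⟩
  rw [hν] at hd hmax hψ
  rintro ⟨v, hvA⟩ hv
  change v ∈ t at hv
  have hvA' : {v} ∈ A' := singleton_mem_of_mem ht.2 hv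
  obtain ⟨i, x, rfl⟩ := ν.exists_eq_vertex hvA
  obtain ⟨μ, hμd, hμv⟩ := Δ.exists_chart hA hA' ν (Or.inr hd.1) (Or.inr hvA) (Or.inr hd.2)
    (Or.inr hvA')
  have hface : ν.face {i}ᶜ x = {ν.vertex i x} := by
    ext v
    simp [Chart.mem_face]
  have h1 := (ν.map ψ).vertex_eq_of_conj_mem μ (I := I) (i := i) (x := x)
    (fun k hk ↦ by
      rw [ν.map_vertex, hμd k 1 (ν.vertex_mem_face hk)]
      exact hψ _ (ν.vertex_mem_face hk))
    (fun j hj ↦ conj_mem_of_card_le hA hA' hd hmax (hface ▸ hvA') hj)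
  rw [hμv i x (by simp)] at h1
  exact h1

/-! ### Type-preserving isomorphisms -/

theorem isChamber_chamber [Nonempty B] (hA : A ∈ Δ.apartments) (c : Chart M A) (w : M.Group) :
    Δ.toPreAbstractSimplicialComplex.IsChamber (c.chamber w) := by
  refine ⟨Δ.apartment_le A hA (c.chamber_mem w), fun t ht h ↦ ?_⟩
  obtain ⟨F, hF, hFt, -⟩ := Δ.exists_apartment t t (Or.inr ht) (Or.inr ht)
  obtain ⟨φ, -⟩ := Δ.exists_chart hA hF c (Or.inl rfl) (Or.inl rfl) (Or.inl rfl) (Or.inl rfl)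
  have h1 := φ.card_le_of_mem (hFt.resolve_left (nonempty_of_mem ht).ne_empty)
  exact (Finset.eq_of_subset_of_card_le h (by rwa [c.card_chamber])).ge

/-- A type function takes the same value on all vertices which have the same type in a chart. -/
theorem IsTypeFunction.apply_vertex {n : ℕ} {τ : V → Fin n} (hτ : Δ.IsTypeFunction τ)
    (hA : A ∈ Δ.apartments) (c : Chart M A) (i : B) (w : M.Group) :
    τ (c.vertex i w) = τ (c.vertex i 1) := by
  have : Nonempty B := ⟨i⟩
  induction w using M.toCoxeterSystem.simple_induction_right with
  | one => rfl
  | mul_simple_right w j ih =>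
    rw [← ih]
    by_cases hij : i = j
    · subst hij
      have h1 := hτ _ (isChamber_chamber hA c w)
      have h2 := hτ _ (isChamber_chamber hA c (w * M.toCoxeterSystem.simple i))
      obtain ⟨v, hv, hvτ⟩ :=
        h1.surjOn (Set.mem_univ (τ (c.vertex i (w * M.toCoxeterSystem.simple i))))
      obtain ⟨k, rfl⟩ := c.mem_chamber.1 hv
      by_cases hki : k = i
      · rw [← hvτ, hki]
      · rw [← c.vertex_mul_simple hki] at hvτ
        exact absurd (c.type_eq (h2.injOn (c.vertex_mem_chamber _ _) (c.vertex_mem_chamber _ _)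
          hvτ)) hki
    · rw [c.vertex_mul_simple hij]

/-- Two apartments are isomorphic by a type-preserving isomorphism which fixes a given common
simplex, through an apartment which contains a chamber of each of them. -/
theorem exists_typePreserving_fixes (hA : A ∈ Δ.apartments) (hA' : A' ∈ Δ.apartments)
    (c : Chart M A) {d : Finset V} (hd : A.IsSimplex d) (hd' : A'.IsSimplex d) :
    ∃ φ : Iso A A', Δ.TypePreserving φ ∧ φ.Fixes d := by
  obtain ⟨y, hy⟩ := c.exists_subset_chamber hd
  obtain ⟨β, -⟩ := Δ.exists_chart hA hA' c (Or.inl rfl) (Or.inl rfl) (Or.inl rfl) (Or.inl rfl)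
  obtain ⟨w, hw⟩ := β.exists_subset_chamber hd'
  obtain ⟨E, hE, h1, h2⟩ := Δ.exists_apartment _ _
    (Δ.isSimplex_of_apartment hA (c.chamber_isSimplex y))
    (Δ.isSimplex_of_apartment hA' (β.chamber_isSimplex w))
  obtain ⟨ε, hε, -⟩ := Δ.exists_chart hA hE c (c.chamber_isSimplex y) (c.chamber_isSimplex y) h1 h1
  obtain ⟨z, hz⟩ := ε.exists_subset_chamber h2
  have hch : β.chamber w = ε.chamber z :=
    Finset.eq_of_subset_of_card_le hz (by rw [β.card_chamber, ε.card_chamber])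
  have hz' : A'.IsSimplex (ε.chamber z) := hch ▸ β.chamber_isSimplex w
  obtain ⟨μ, hμ, -⟩ := Δ.exists_chart hE hA' ε (ε.chamber_isSimplex z) (ε.chamber_isSimplex z)
    hz' hz'
  have hεy (i : B) : ε.vertex i y = c.vertex i y := hε i y (c.vertex_mem_chamber i y)
  have hμz (i : B) : μ.vertex i z = ε.vertex i z := hμ i z (ε.vertex_mem_chamber i z)
  obtain ⟨φ, hφ⟩ := c.exists_iso μ
  refine ⟨φ, ?_, ?_⟩
  · rintro n τ hτ ⟨v, hv⟩
    obtain ⟨i, w, rfl⟩ := c.exists_eq_vertex hv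
    rw [hφ, hτ.apply_vertex hA' μ, ← hτ.apply_vertex hA' μ i z, hμz, hτ.apply_vertex hE ε,
      ← hτ.apply_vertex hE ε i y, hεy, hτ.apply_vertex hA c, ← hτ.apply_vertex hA c i w]
  · rintro ⟨v, hvA⟩ hv
    change v ∈ d at hv
    obtain ⟨i, rfl⟩ := c.mem_chamber.1 (hy hv)
    rw [hφ]
    change μ.vertex i y = c.vertex i y
    have h3 : c.vertex i y ∈ ε.chamber z := hz (hw hv)
    rw [← hεy] at h3 ⊢
    obtain ⟨k, hk⟩ := ε.mem_chamber.1 h3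
    obtain ⟨rfl, h4⟩ := (ε.vertex_eq_vertex _ _ _ _).1 hk
    rw [hk, μ.vertex_eq_iff.2 h4, hμz]

end Building

/-! ### Half-apartments in a chart -/

namespace PreAbstractSimplicialComplex.Chart

variable {V B : Type*} [Fintype B] [Nonempty B] {M : CoxeterMatrix B}
  {A : PreAbstractSimplicialComplex V} (c : Chart M A)

/-- The chamber corresponding to `w`, as a vertex of the graph of chambers. -/
noncomputable def chamberNode (w : M.Group) : {t : Finset V // A.IsChamber t} :=
  ⟨c.chamber w, c.isChamber_iff.2 ⟨w, rfl⟩⟩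

theorem chamberNode_surjective : Function.Surjective c.chamberNode := by
  rintro ⟨t, ht⟩
  obtain ⟨w, rfl⟩ := c.isChamber_iff.1 ht
  exact ⟨w, rfl⟩

theorem chamberGraph_adj_iff {w w' : M.Group} :
    A.chamberGraph.Adj (c.chamberNode w) (c.chamberNode w') ↔
      ∃ j, w' = w * M.toCoxeterSystem.simple j := by
  constructor
  · rintro ⟨hne, p, hp, hp', hcard, -⟩
    obtain ⟨I, rfl⟩ := c.exists_eq_face hp
    have h1 := c.card_face I w
    change (c.face I w).card + 1 = (c.chamber w).card at hcard
    rw [c.card_chamber] at hcard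
    obtain ⟨j, rfl⟩ := Set.ncard_eq_one.1 (show I.ncard = 1 by omega)
    refine ⟨j, ?_⟩
    rcases M.toCoxeterSystem.mem_parabolic_singleton (c.face_subset_chamber_iff.1 hp') with h | h
    · exact absurd (by rw [inv_mul_eq_one.1 h]) hne
    · rw [← h, mul_inv_cancel_left]
  · rintro ⟨j, rfl⟩
    have h1 := c.card_face {j} w
    rw [Set.ncard_singleton] at h1
    refine ⟨fun h ↦ mul_simple_ne w j (c.chamber_injective (congrArg Subtype.val h)).symm,
      c.face {j} w, c.face_subset_chamber _ _, c.face_subset_chamber_iff.2 ?_, ?_, ?_⟩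
    · simpa using M.toCoxeterSystem.simple_mem_parabolic (Set.mem_singleton j)
    · rw [h1]; exact (c.card_chamber _).symm
    · rw [h1]; exact (c.card_chamber _).symm

theorem exists_walk (w g : M.Group) :
    ∃ p : A.chamberGraph.Walk (c.chamberNode w) (c.chamberNode (w * g)),
      p.length = M.toCoxeterSystem.length g := by
  have hg : g ∈ M.toCoxeterSystem.parabolic Set.univ := by
    rw [M.toCoxeterSystem.parabolic_univ]; trivial
  refine M.toCoxeterSystem.parabolic_induction_right
    (p := fun g ↦ ∃ p : A.chamberGraph.Walk (c.chamberNode w) (c.chamberNode (w * g)),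
      p.length = M.toCoxeterSystem.length g) ?_ ?_ hg
  · rw [mul_one]
    exact ⟨.nil, by simp⟩
  · rintro j - g - hlt ⟨p, hp⟩
    rw [← mul_assoc]
    refine ⟨p.concat (c.chamberGraph_adj_iff.2 ⟨j, rfl⟩), ?_⟩
    have := M.toCoxeterSystem.length_mul_simple g j
    rw [SimpleGraph.Walk.length_concat]
    omega

theorem length_le_walk_length {a b : {t : Finset V // A.IsChamber t}}
    (p : A.chamberGraph.Walk a b) : ∀ w w', c.chamberNode w = a → c.chamberNode w' = b →
      M.toCoxeterSystem.length (w⁻¹ * w') ≤ p.length := by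
  induction p with
  | nil =>
    intro w w' h h'
    obtain rfl : w = w' := c.chamber_injective (congrArg Subtype.val (h.trans h'.symm))
    simp
  | @cons a b d hab p ih =>
    rintro w w' rfl h'
    obtain ⟨z, rfl⟩ := c.chamberNode_surjective b
    obtain ⟨j, rfl⟩ := c.chamberGraph_adj_iff.1 hab
    have h1 := ih _ w' rfl h'
    have h2 := M.toCoxeterSystem.length_simple_mul
      (M.toCoxeterSystem.simple j * (w⁻¹ * w')) j
    rw [M.toCoxeterSystem.simple_mul_simple_cancel_left] at h2
    rw [mul_inv_rev, M.toCoxeterSystem.inv_simple, mul_assoc] at h1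
    rw [SimpleGraph.Walk.length_cons]
    omega

theorem chamberGraph_dist (w w' : M.Group) :
    A.chamberGraph.dist (c.chamberNode w) (c.chamberNode w') =
      M.toCoxeterSystem.length (w⁻¹ * w') := by
  obtain ⟨p, hp⟩ := c.exists_walk w (w⁻¹ * w')
  have hw : w * (w⁻¹ * w') = w' := mul_inv_cancel_left w w'
  rw [← hp]
  refine le_antisymm ?_ ?_
  · conv_lhs => rw [← hw]
    exact SimpleGraph.dist_le p
  · have hr : A.chamberGraph.Reachable (c.chamberNode w) (c.chamberNode w') := by
      rw [← hw]
      exact ⟨p⟩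
    obtain ⟨q, hq⟩ := hr.exists_walk_length_eq_dist
    rw [hp, ← hq]
    exact c.length_le_walk_length q _ _ rfl rfl

/-- The half-apartment of the chambers closer to `u` than to the `j`-adjacent chamber. -/
noncomputable def halfSpace (u : M.Group) (j : B) : Set (Finset V) :=
  A.closerTo (c.chamberNode u) (c.chamberNode (u * M.toCoxeterSystem.simple j))

theorem isHalfApartment_halfSpace (u : M.Group) (j : B) :
    A.IsHalfApartment (c.halfSpace u j) :=
  ⟨_, _, c.chamberGraph_adj_iff.2 ⟨j, rfl⟩, rfl⟩

theorem face_mem_halfSpace_iff {K : Set B} {u g : M.Group} {j : B}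
    (hne : (c.face K g).Nonempty) :
    c.face K g ∈ c.halfSpace u j ↔ ∃ v ∈ M.toCoxeterSystem.parabolic K,
      M.toCoxeterSystem.length (u⁻¹ * (g * v)) <
        M.toCoxeterSystem.length (M.toCoxeterSystem.simple j * (u⁻¹ * (g * v))) := by
  have hdist (e : M.Group) :
      A.chamberGraph.dist (c.chamberNode e) (c.chamberNode u) <
        A.chamberGraph.dist (c.chamberNode e) (c.chamberNode (u * M.toCoxeterSystem.simple j)) ↔
      M.toCoxeterSystem.length (u⁻¹ * e) <
        M.toCoxeterSystem.length (M.toCoxeterSystem.simple j * (u⁻¹ * e)) := by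
    rw [c.chamberGraph_dist, c.chamberGraph_dist, ← M.toCoxeterSystem.length_inv (e⁻¹ * u),
      ← M.toCoxeterSystem.length_inv (e⁻¹ * (u * _)), mul_inv_rev, mul_inv_rev, mul_inv_rev,
      inv_inv, M.toCoxeterSystem.inv_simple, mul_assoc]
  constructor
  · rintro ⟨-, e, he, hsub⟩
    obtain ⟨e, rfl⟩ := c.chamberNode_surjective e
    refine ⟨g⁻¹ * e, c.face_subset_chamber_iff.1 hsub, ?_⟩
    rw [mul_inv_cancel_left]
    exact (hdist e).1 he
  · rintro ⟨v, hv, hlt⟩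
    exact ⟨c.face_mem hne, c.chamberNode (g * v), (hdist _).2 hlt,
      c.face_subset_chamber_iff.2 (by simpa using hv)⟩

end PreAbstractSimplicialComplex.Chart

/-! ### Intersections of apartments are closed -/

namespace Building

open PreAbstractSimplicialComplex

variable {V : Type*} {Δ : Building V} {B : Type*} {M : CoxeterMatrix B}
  {A A' : PreAbstractSimplicialComplex V} [Fintype B] [Nonempty B]

/-- If a simplex of `A` does not lie on some wall that contains a common simplex `d` of maximal
dimension, then one of the two half-apartments of this wall separates it from `A ⊓ A'`. -/
theorem exists_separating_of_conj_notMem (hA : A ∈ Δ.apartments) (hA' : A' ∈ Δ.apartments)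
    {ν : Chart M A} {I K : Set B} {x : M.Group} (hd : ν.face I 1 ∈ A ⊓ A')
    (hmax : ∀ e ∈ A ⊓ A', e.card ≤ (ν.face I 1).card) (hne : (ν.face K x).Nonempty)
    {i : B} (hi : i ∈ I)
    (hx : x⁻¹ * M.toCoxeterSystem.simple i * x ∉ M.toCoxeterSystem.parabolic K) :
    ∃ H, A.IsHalfApartment H ∧ (A ⊓ A').faces ⊆ H ∧ ν.face K x ∉ H := by
  set cs := M.toCoxeterSystem with hcs
  by_cases hlt : cs.length (cs.simple i * x) < cs.length x
  · refine ⟨ν.halfSpace 1 i, ν.isHalfApartment_halfSpace 1 i, fun z hz ↦ ?_, fun h ↦ ?_⟩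
    · obtain ⟨K', g, rfl⟩ := ν.exists_eq_face_of_mem hz.1
      obtain ⟨v, hv, h⟩ := (cs.exists_length_lt_of_conj_mem
        (conj_mem_of_card_le hA hA' hd hmax hz.2 hi)).1
      exact (ν.face_mem_halfSpace_iff (nonempty_of_mem hz.1)).2 ⟨v, hv, by rwa [inv_one, one_mul]⟩
    · obtain ⟨v, hv, h⟩ := (ν.face_mem_halfSpace_iff hne).1 h
      rw [inv_one, one_mul, ← hcs] at h
      have := (cs.length_lt_of_conj_notMem hx hv).2 hlt
      omega
  · refine ⟨ν.halfSpace (cs.simple i) i, ν.isHalfApartment_halfSpace _ i, fun z hz ↦ ?_,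
      fun h ↦ ?_⟩
    · obtain ⟨K', g, rfl⟩ := ν.exists_eq_face_of_mem hz.1
      obtain ⟨v, hv, h⟩ := (cs.exists_length_lt_of_conj_mem
        (conj_mem_of_card_le hA hA' hd hmax hz.2 hi)).2
      refine (ν.face_mem_halfSpace_iff (nonempty_of_mem hz.1)).2 ⟨v, hv, ?_⟩
      rwa [← hcs, cs.inv_simple, cs.simple_mul_simple_cancel_left]
    · obtain ⟨v, hv, h⟩ := (ν.face_mem_halfSpace_iff hne).1 h
      rw [← hcs, cs.inv_simple, cs.simple_mul_simple_cancel_left] at h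
      exact hlt ((cs.length_lt_of_conj_notMem hx hv).1 h)

/-- Every simplex `e` of `A` outside `A'` is separated by a half-apartment of `A` from `A ⊓ A'`, if
the latter is not empty. The induction brings a common simplex `d = ν.face I 1` of maximal dimension
and a chamber `x` containing `e` as close to each other as possible. Then a wall which separates `d`
from `x` and contains a facet of `d` is as required: a common simplex beyond this wall would have a
projection to the facet that is again of maximal dimension and closer to `x` than `d`. -/
theorem exists_separating (hA : A ∈ Δ.apartments) (hA' : A' ∈ Δ.apartments)
    (ν : Chart M A) {I : Set B} {x : M.Group} (hd : ν.face I 1 ∈ A ⊓ A')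
    (hmax : ∀ e ∈ A ⊓ A', e.card ≤ (ν.face I 1).card) {e : Finset V} (he : e ∈ A)
    (hex : e ⊆ ν.chamber x) (heA' : e ∉ A') :
    ∃ H, A.IsHalfApartment H ∧ (A ⊓ A').faces ⊆ H ∧ e ∉ H := by
  induction hn : M.toCoxeterSystem.length x using Nat.strong_induction_on generalizing ν I x with
  | _ n ih =>
  set cs := M.toCoxeterSystem with hcs
  obtain ⟨K, rfl⟩ := ν.exists_eq_face hex
  have hne := nonempty_of_mem he
  by_cases hL : ∀ i ∈ I, x⁻¹ * cs.simple i * x ∈ cs.parabolic K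
  swap
  · push Not at hL
    obtain ⟨i, hi, h⟩ := hL
    exact exists_separating_of_conj_notMem hA hA' hd hmax hne hi h
  -- Replace `x` by the chamber of the residue that is closest to `1`.
  obtain ⟨y, hyx, hle, hy, hyK⟩ := cs.exists_isTransporter hL
  rw [← ν.face_eq_of_mem hyx] at he heA' hne ih ⊢
  by_cases hy1 : y = 1
  · subst hy1
    rw [cs.transport_one] at hyK
    exact absurd (mem_of_subset hd.2 (ν.face_anti hyK 1) hne) heA'
  obtain ⟨k, hk⟩ := cs.exists_leftDescent_of_ne_one hy1
  rw [CoxeterSystem.IsLeftDescent] at hk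
  have hkI : k ∉ I := fun h ↦ by
    have := hy.1 k h
    omega
  by_cases hkK : y⁻¹ * cs.simple k * y ∈ cs.parabolic K
  · refine ih _ (show cs.length (cs.simple k * y) < n by omega) ν hd hmax ?_ rfl
    rw [ν.face_subset_chamber_iff, ← mul_assoc]
    exact hkK
  by_contra hcon
  have hZ : ¬ (A ⊓ A').faces ⊆ ν.halfSpace 1 k := by
    intro hZ
    refine hcon ⟨_, ν.isHalfApartment_halfSpace 1 k, hZ, fun h ↦ ?_⟩
    obtain ⟨v, hv, h⟩ := (ν.face_mem_halfSpace_iff hne).1 h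
    rw [inv_one, one_mul, ← hcs] at h
    have := (cs.length_lt_of_conj_notMem hkK hv).2 hk
    omega
  rw [Set.not_subset] at hZ
  obtain ⟨z, hz, hzH⟩ := hZ
  obtain ⟨K', g, rfl⟩ := ν.exists_eq_face_of_mem hz.1
  have hfar : ∀ v ∈ cs.parabolic K', ¬ cs.length (g * v) < cs.length (cs.simple k * (g * v)) := by
    intro v hv h
    exact hzH ((ν.face_mem_halfSpace_iff (nonempty_of_mem hz.1)).2 ⟨v, hv, by rwa [inv_one, one_mul]⟩)
  -- The chamber `p` contains the projection of `z` to the facet `ν.face (insert k I) 1` of `d`.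
  obtain ⟨p, hp, h, hh, rfl⟩ := cs.exists_mul_isLeftReduced (insert k I) g
  set P := {j ∈ insert k I | h⁻¹ * cs.simple j * h ∈ cs.parabolic K'} with hP
  have hfacet : (ν.translate p).face (insert k I) 1 = ν.face (insert k I) 1 := by
    rw [ν.translate_face, mul_one]
    exact (ν.face_eq_of_mem (by simpa using hp)).symm
  have hfacet' : A'.IsSimplex ((ν.translate p).face (insert k I) 1) := by
    rw [hfacet]
    exact (Finset.eq_empty_or_nonempty _).imp id
      (mem_of_subset hd.2 (ν.face_anti (Set.subset_insert k I) 1))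
  have hD : A'.IsSimplex (ν.face P p) := by
    have := face_isSimplex_of_isLeftReduced hA hA' hfacet' (Or.inr hz.2) hh
    rwa [ν.translate_face, mul_one] at this
  have hPJ : P ⊆ insert k I := fun j hj ↦ hj.1
  have hPne : P ≠ insert k I := by
    intro hPeq
    have h1 : p⁻¹ * cs.simple k * p ∈ cs.parabolic P := by
      rw [hPeq]
      exact mul_mem (mul_mem (inv_mem hp) (cs.simple_mem_parabolic (Set.mem_insert k I))) hp
    have h2 := cs.conj_mem_of_mem_parabolic (fun j hj ↦ hj.2) h1
    have h3 : h⁻¹ * (p⁻¹ * cs.simple k * p) * h = (p * h)⁻¹ * cs.simple k * (p * h) := by group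
    rw [h3] at h2
    obtain ⟨v, hv, hlt⟩ := (cs.exists_length_lt_of_conj_mem h2).1
    exact hfar v hv hlt
  have hPcard : P.ncard ≤ I.ncard := by
    have h1 := Set.ncard_lt_ncard (hPJ.ssubset_of_ne hPne)
    rw [Set.ncard_insert_of_notMem hkI] at h1
    omega
  have hcard1 := ν.card_face I 1
  have hcard2 := ν.card_face P p
  have hdpos := (nonempty_of_mem hd.1).card_pos
  have hDne : (ν.face P p).Nonempty := Finset.card_pos.1 (by omega)
  have hDmem : ν.face P p ∈ A ⊓ A' := ⟨ν.face_mem hDne, hD.resolve_left hDne.ne_empty⟩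
  have hDcard : (ν.face P p).card = (ν.face I 1).card :=
    le_antisymm (hmax _ hDmem) (by omega)
  obtain ⟨u, hup, -, hu, huP⟩ := cs.exists_isTransporter
    fun i hi ↦ conj_mem_of_card_le hA hA' hd hmax hDmem.2 hi
  have huJ : u ∈ cs.parabolic (insert k I) := by
    have h1 : u = p * (u⁻¹ * p)⁻¹ := by group
    rw [h1]
    exact mul_mem hp (inv_mem (cs.parabolic_mono hPJ hup))
  rw [← ν.face_eq_of_mem hup] at hDmem hDcard
  have hu1 : u ≠ 1 := by
    rintro rfl
    rw [cs.transport_one] at huP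
    have hIP : I = P := Set.eq_of_subset_of_ncard_le huP hPcard
    rw [inv_one, one_mul, ← hIP] at hup
    have h1 := cs.conj_mem_of_mem_parabolic
      (fun i hi ↦ conj_mem_of_card_le hA hA' hd hmax hz.2 hi) (inv_mem hup)
    have h2 : p * h * ((p * h)⁻¹ * p⁻¹ * (p * h)) = h := by group
    have h3 := hfar _ h1
    rw [h2] at h3
    exact h3 (hh k (Set.mem_insert k I))
  obtain ⟨u', hu', x', -, rfl, hu1', hut, -, hlt⟩ := hy.exists_eq_mul cs hk
  obtain rfl := hu.eq_of_mem_parabolic cs hut hu1 hu1' huJ hu'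
  refine hcon (ih _ (show cs.length x' < n by omega) (ν.translate u) (I := P) ?_ ?_ ?_ rfl)
  · rwa [ν.translate_face, mul_one]
  · rwa [ν.translate_face, mul_one, hDcard]
  · exact ν.face_subset_chamber K _

/-- The empty set is an intersection of half-apartments; this is the case of two apartments
without a common vertex. -/
theorem exists_isHalfApartment_notMem (c : Chart M A) {e : Finset V} (he : e ∈ A) :
    ∃ H, A.IsHalfApartment H ∧ e ∉ H := by
  obtain ⟨K, x, rfl⟩ := c.exists_eq_face_of_mem he
  have hne := nonempty_of_mem he
  obtain ⟨v, hv⟩ := hne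
  obtain ⟨k, hk, rfl⟩ := c.mem_face.1 hv
  set cs := M.toCoxeterSystem with hcs
  refine ⟨_, c.isHalfApartment_halfSpace (x * cs.simple k) k, fun h ↦ ?_⟩
  obtain ⟨v, hv, h⟩ := (c.face_mem_halfSpace_iff ⟨_, hv⟩).1 h
  have h1 : (x * cs.simple k)⁻¹ * (x * v) = cs.simple k * v := by
    rw [mul_inv_rev, cs.inv_simple]
    group
  rw [h1, ← hcs, cs.simple_mul_simple_cancel_left] at h
  exact hk (cs.mem_of_length_simple_mul_lt hv h)

omit [Nonempty B] in
theorem exists_forall_card_le (c : Chart M A) (h : (A ⊓ A').faces.Nonempty) :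
    ∃ d ∈ A ⊓ A', ∀ e ∈ A ⊓ A', e.card ≤ d.card := by
  obtain ⟨d, hd, hmin⟩ :=
    (measure fun e : Finset V ↦ Fintype.card B - e.card).wf.has_min (A ⊓ A').faces h
  refine ⟨d, hd, fun e he ↦ ?_⟩
  have h1 := hmin e he
  change ¬ Fintype.card B - e.card < Fintype.card B - d.card at h1
  have h2 := c.card_le_of_mem he.1
  have h3 := c.card_le_of_mem hd.1
  omega

omit [Nonempty B] in
theorem isClosedIn_inf (hA : A ∈ Δ.apartments) (hA' : A' ∈ Δ.apartments) (c : Chart M A) :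
    A.IsClosedIn (A ⊓ A').faces := by
  refine ⟨{H | A.IsHalfApartment H ∧ (A ⊓ A').faces ⊆ H}, fun H hH ↦ hH.1,
    Set.Subset.antisymm (fun e he ↦ ⟨he.1, fun H hH ↦ hH.2 he⟩) ?_⟩
  rintro e ⟨he, hH⟩
  refine ⟨he, ?_⟩
  by_contra heA'
  obtain ⟨v, hv⟩ := nonempty_of_mem he
  obtain ⟨i, -, -⟩ := c.exists_eq_vertex (singleton_mem_of_mem he hv)
  have : Nonempty B := ⟨i⟩
  rcases (A ⊓ A').faces.eq_empty_or_nonempty with h0 | hne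
  · obtain ⟨H, h1, h2⟩ := exists_isHalfApartment_notMem c he
    exact h2 (hH H ⟨h1, by simp [h0]⟩)
  · obtain ⟨d, hd, hmax⟩ := exists_forall_card_le c hne
    obtain ⟨I, y, rfl⟩ := c.exists_eq_face_of_mem hd.1
    have hy : c.face I y = (c.translate y).face I 1 := by rw [c.translate_face, mul_one]
    rw [hy] at hd hmax
    obtain ⟨x, hx⟩ := (c.translate y).exists_subset_chamber (Or.inr he)
    obtain ⟨H, h1, h2, h3⟩ := exists_separating hA hA' (c.translate y) hd hmax he hx heA'
    exact h3 (hH H ⟨h1, h2⟩)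

end Building

theorem proposition4p1p10 {V : Type*} (Δ : Building V) (A B : PreAbstractSimplicialComplex V)
    (hA : A ∈ Δ.apartments) (hB : B ∈ Δ.apartments) :
    -- the intersection is closed in both apartments
    A.IsClosedIn (A ⊓ B).faces ∧ B.IsClosedIn (A ⊓ B).faces ∧
    -- there is a type-preserving isomorphism fixing the intersection
    (∃ φ : PreAbstractSimplicialComplex.Iso A B,
      Δ.TypePreserving φ ∧ ∀ s ∈ A ⊓ B, φ.Fixes s) ∧
    -- an isomorphism fixing a facet of maximal dimension fixes the intersection
    (∀ ψ : PreAbstractSimplicialComplex.Iso A B, ∀ d ∈ A ⊓ B,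
      (∀ e ∈ A ⊓ B, e.card ≤ d.card) → ψ.Fixes d → ∀ s ∈ A ⊓ B, ψ.Fixes s) := by
  obtain ⟨n, M, ⟨c⟩⟩ := (Δ.isCoxeterComplex A hA).exists_chart
  obtain ⟨m, N, ⟨c'⟩⟩ := (Δ.isCoxeterComplex B hB).exists_chart
  refine ⟨Building.isClosedIn_inf hA hB c, ?_, ?_, fun ψ d hd hmax hψ s hs ↦
    Building.fixes_of_card_le hA hB c ψ hd hmax hψ hs⟩
  · rw [inf_comm]
    exact Building.isClosedIn_inf hB hA c'
  · rcases (A ⊓ B).faces.eq_empty_or_nonempty with h0 | hne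
    · obtain ⟨φ, hφ, -⟩ := Building.exists_typePreserving_fixes hA hB c (Or.inl rfl) (Or.inl rfl)
      exact ⟨φ, hφ, fun s hs ↦ absurd (show s ∈ (A ⊓ B).faces from hs) (by simp [h0])⟩
    · obtain ⟨d, hd, hmax⟩ := Building.exists_forall_card_le c hne
      obtain ⟨φ, hφ, hφd⟩ :=
        Building.exists_typePreserving_fixes hA hB c (Or.inr hd.1) (Or.inr hd.2)
      exact ⟨φ, hφ, fun s hs ↦ Building.fixes_of_card_le hA hB c φ hd hmax hφd hs⟩
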